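/- Let $m,n\in\mathbb{N}$, let $\lambda/\mu$ be a skew partition of $mn$, let $\gamma=(\gamma_1,\dots,\gamma_d)$ be a composition of $n$ (with positive parts), and let $g\in S_n$ have cycle type $\gamma$ (fixed points counted as parts $1$, order of the parts disregarded). Then $$(\mathrm{Defres}_{S_n}\,\chi^{\lambda/\mu})(g)=a_{\lambda/\mu,\gamma}.$$ Here the notation is as follows. *Skew characters.* $\chi^{\lambda/\mu}$ is the character of $S_{mn}$ labelled by $\lambda/\mu$, given by $$\chi^{\lambda/\mu}=\sum_{\pi\in S_\ell}\mathrm{sgn}(\pi)\,\xi^{\alpha(\pi)},\qquad \alpha(\pi)_i=(\lambda_i-i)-(\mu_{\pi(i)}-\pi(i)),$$ where $\ell$ is the number of parts of $\lambda$ and $\xi^\alpha$ is the permutation character of $S_{mn}$ induced from the trivial character of the Young subgroup $S_{\alpha_1}\times\cdots\times S_{\alpha_\ell}$ (and $\xi^\alpha=0$ if some $\alpha_i<0$); equivalently, the Frobenius characteristic of $\chi^{\lambda/\mu}$ is the skew Schur function $s_{\lambda/\mu}$. *Deflation.* $S_m\wr S_n\le S_{mn}$ is the wreath product acting imprimitively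 on $\{1,\dots,m\}\times\{1,\dots,n\}$, with base group $S_m\times\cdots\times S_m$ ($n$ factors). For an irreducible character $\xi$ of $S_m\wr S_n$, let $\mathrm{Def}_{S_n}\xi=\eta$ if $\xi$ is the inflation, along $S_m\wr S_n\twoheadrightarrow S_n$, of an irreducible character $\eta$ of $S_n$, and $\mathrm{Def}_{S_n}\xi=0$ otherwise; extend $\mathrm{Def}_{S_n}$ linearly to virtual characters. Then $\mathrm{Defres}_{S_n}\chi=\mathrm{Def}_{S_n}\bigl(\mathrm{Res}_{S_m\wr S_n}\chi\bigr)$ for $\chi$ a virtual character of $S_{mn}$; that is, one restricts to $S_m\wr S_n$ and keeps the constituents on which the base group acts trivially. *Border-strip tableaux.* A border strip is a non-empty skew diagram that is connected (through edges of boxes) and contains no $2\times2$ square. Its length is its number of boxes, its height is one less than the number of rows it meets, and its row number is the number of the topmost row it meets (rows are numbered from the top). A border-strip tableau of shape $\lambda/\mu$ and type $(\alpha_1,\dots,\alpha_k)$ is a labelling of the boxes of $\lambda/\mu$ by $1,\dots,k$, non-decreasing along rows (left to right) and down columns, such that for each $j$ the boxes labelled $j$ form a border strip of length $\alpha_j$;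 its sign is $(-1)^h$, with $h$ the sum of the heights of its strips. Let $\gamma^{\star m}=(\gamma_1,\dots,\gamma_1,\dots,\gamma_d,\dots,\gamma_d)$, each part repeated $m$ times. An $m$-border-strip tableau of shape $\lambda/\mu$ and type $\gamma$ is a border-strip tableau of shape $\lambda/\mu$ and type $\gamma^{\star m}$ such that for each $j\in\{1,\dots,d\}$ the row numbers of the strips labelled $(j-1)m+1,\ (j-1)m+2,\dots,\ jm$ form a weakly decreasing sequence. Finally $a_{\lambda/\mu,\gamma}$ is the sum of the signs of all $m$-border-strip tableaux of shape $\lambda/\mu$ and type $\gamma$. -/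

import Mathlib

open Equiv Finset

/-! ### Wreath products and deflation of characters -/

/-- The wreath product `S_m ≀ S_n`, as the semidirect product of the base group
`S_m × ⋯ × S_m` by `S_n`, where `g ∈ S_n` sends `(h_j)_j` to `(h_{g⁻¹ j})_j`. -/
abbrev WreathSymm (m n : ℕ) : Type :=
  (Fin n → Perm (Fin m)) ⋊[mulAutArrow] Perm (Fin n)

noncomputable instance (m n : ℕ) : Fintype (WreathSymm m n) :=
  Fintype.ofEquiv ((Fin n → Perm (Fin m)) × Perm (Fin n)) SemidirectProduct.equivProd.symm

/-- The imprimitive embedding of `S_m ≀ S_n` into `S_{mn}`, realised as the symmetric group on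
`{1,…,m} × {1,…,n}`: the element `(h₁,…,hₙ; g)` sends `(i, j)` to `(h_{gj} i, g j)`. -/
def wreathEmb (m n : ℕ) : WreathSymm m n →* Perm (Fin m × Fin n) where
  toFun w :=
    { toFun := fun x => (w.left (w.right x.2) x.1, w.right x.2)
      invFun := fun x => ((w.left x.2)⁻¹ x.1, w.right⁻¹ x.2)
      left_inv := fun x => by simp
      right_inv := fun x => by simp }
  map_one' := by ext x <;> simp
  map_mul' v w := by
    have h : ∀ (g : Perm (Fin n)) (F : Fin n → Perm (Fin m)) (j : Fin n),
        (mulAutArrow g F) (g j) = F j := fun g F j => congrArg F (g.symm_apply_apply j)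
    refine Equiv.ext fun x => Prod.ext ?_ rfl
    exact congrArg (fun q : Perm (Fin m) => v.left (v.right (w.right x.2)) (q x.1))
      (h v.right w.left (w.right x.2))

/-- The irreducible complex characters of a group, as a set of functions. -/
def irreducibleCharacters (G : Type) [Group G] : Set (G → ℂ) :=
  {χ | ∃ (V : Type) (_ : AddCommGroup V) (_ : Module ℂ V) (ρ : Representation ℂ G V),
    FiniteDimensional ℂ V ∧ ρ.IsIrreducible ∧ χ = ρ.character}

/-- The usual inner product of complex functions on a finite group. -/
noncomputable def charInner {G : Type} [Group G] [Fintype G] (φ ψ : G → ℂ) : ℂ :=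
  (Fintype.card G : ℂ)⁻¹ * ∑ g, φ g * star (ψ g)

/-- Inflation of functions along the canonical surjection `S_m ≀ S_n ↠ S_n`. -/
def inflation {m n : ℕ} (η : Perm (Fin n) → ℂ) : WreathSymm m n → ℂ :=
  fun w => η w.right

open Classical in
/-- Deflation of an irreducible character `ξ` of `S_m ≀ S_n` (with respect to the trivial
character of `S_m`): it is `η` if `ξ` is the inflation of the irreducible character `η` of `S_n`,
and `0` if `ξ` is not an inflation. (Inflation is injective, so `η` is unique.) -/
noncomputable def deflationIrr {m n : ℕ} (ξ : WreathSymm m n → ℂ) : Perm (Fin n) → ℂ :=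
  if h : ∃ η ∈ irreducibleCharacters (Perm (Fin n)), ξ = inflation η then h.choose else 0

/-- Deflation, the linear extension of `deflationIrr`: a virtual character `ψ` of `S_m ≀ S_n` is
`∑ ⟨ψ, ξ⟩ ξ` over the (finitely many) irreducible characters `ξ`. -/
noncomputable def deflation {m n : ℕ} (ψ : WreathSymm m n → ℂ) : Perm (Fin n) → ℂ :=
  ∑ᶠ ξ ∈ irreducibleCharacters (WreathSymm m n), charInner ψ ξ • deflationIrr ξ

/-- Restriction from `S_{mn}` to `S_m ≀ S_n`, followed by deflation to `S_n`. -/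
noncomputable def defres {m n : ℕ} (χ : Perm (Fin m × Fin n) → ℂ) : Perm (Fin n) → ℂ :=
  deflation fun w => χ (wreathEmb m n w)

/-! ### Skew characters of symmetric groups -/

section SkewCharacter

variable {X : Type} [Fintype X] [DecidableEq X]

/-- The Young permutation character of the symmetric group on `X` attached to a sequence `α`
of integers: the permutation character on the ordered set partitions of `X` into blocks
`(f⁻¹{i})_i` of sizes `α i`, that is, the trivial character induced from the Young subgroup `S_α`.
It is `0` if some `α i` is negative or if the `α i` do not add up to `|X|`. -/
def youngPermChar {l : ℕ} (α : Fin l → ℤ) (σ : Perm X) : ℤ :=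
  #{f : X → Fin l | (∀ x, f (σ x) = f x) ∧ ∀ i, (#{x | f x = i} : ℤ) = α i}

/-- The skew character `χ^{λ/μ}` of the symmetric group on `X`, where `|X| = |λ| - |μ|`, by the
Frobenius determinantal construction
`χ^{λ/μ} = ∑_π sgn(π) (1_{S_α})↑` with `α = (λ_i - i - μ_{π i} + π i)_i`,
the sum being over the permutations `π` of the rows of `λ`. With `μ = ∅` this is the irreducible
character `χ^λ`. -/
def skewChar (lam mu : YoungDiagram) (σ : Perm X) : ℤ :=
  ∑ π : Perm (Fin (lam.colLen 0)),
    (Perm.sign π : ℤ) *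
      youngPermChar
        (fun i => ((lam.rowLen i : ℤ) - (i : ℕ)) - ((mu.rowLen (π i) : ℤ) - (π i : ℕ))) σ

end SkewCharacter

/-! ### Border-strip tableaux

Boxes are pairs (row, column), with rows numbered from the top. -/

/-- Two boxes share an edge. -/
def BoxAdj (a b : ℕ × ℕ) : Prop :=
  (a.1 = b.1 ∧ (a.2 + 1 = b.2 ∨ b.2 + 1 = a.2)) ∨
    (a.2 = b.2 ∧ (a.1 + 1 = b.1 ∨ b.1 + 1 = a.1))

/-- A set of boxes (the diagram of a skew partition) is a border strip: it is non-empty,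
connected through edges of boxes, and contains no `2 × 2` square. -/
def IsBorderStrip (S : Finset (ℕ × ℕ)) : Prop :=
  S.Nonempty ∧
    (∀ a ∈ S, ∀ b ∈ S, Relation.ReflTransGen (fun x y => y ∈ S ∧ BoxAdj x y) a b) ∧
    ∀ i j, ¬ ((i, j) ∈ S ∧ (i + 1, j) ∈ S ∧ (i, j + 1) ∈ S ∧ (i + 1, j + 1) ∈ S)

/-- One less than the number of non-empty rows. -/
def stripHeight (S : Finset (ℕ × ℕ)) : ℕ := #(S.image Prod.fst) - 1

/-- The row number of a border strip: the number of the topmost row that it meets. -/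
noncomputable def stripRow (S : Finset (ℕ × ℕ)) : ℕ := sInf {i | ∃ j, (i, j) ∈ S}

/-- The boxes of the skew diagram `λ/μ`. -/
abbrev SkewBox (lam mu : YoungDiagram) : Type := ↥(lam.cells \ mu.cells)

/-- The boxes with label `p` in a labelling `T`. -/
def labelBoxes {lam mu : YoungDiagram} {k : ℕ} (T : SkewBox lam mu → Fin k) (p : Fin k) :
    Finset (ℕ × ℕ) :=
  ({c | T c = p} : Finset (SkewBox lam mu)).image Subtype.val

/-- `T` is a border-strip tableau of shape `λ/μ` and type `α`. The labels `1, …, k` of the strips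
are numbered from `0` here. -/
structure IsBorderStripTableau {lam mu : YoungDiagram} (α : List ℕ)
    (T : SkewBox lam mu → Fin α.length) : Prop where
  row_weak : ∀ c d : SkewBox lam mu, c.1.1 = d.1.1 → c.1.2 ≤ d.1.2 → T c ≤ T d
  col_weak : ∀ c d : SkewBox lam mu, c.1.2 = d.1.2 → c.1.1 ≤ d.1.1 → T c ≤ T d
  strip : ∀ p, IsBorderStrip (labelBoxes T p)
  length_eq : ∀ p, #(labelBoxes T p) = α.get p

/-- The sign of a border-strip tableau. -/
def tableauSign {lam mu : YoungDiagram} {k : ℕ} (T : SkewBox lam mu → Fin k) : ℤ :=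
  (-1) ^ ∑ p, stripHeight (labelBoxes T p)

/-- `γ^{⋆m}`: each part of `γ` repeated `m` times. -/
def starRepeat (m : ℕ) (γ : List ℕ) : List ℕ := γ.flatMap (List.replicate m)

/-- `T` is an `m`-border-strip tableau of type `γ`: a border-strip tableau of type `γ^{⋆m}` such
that the row numbers of the `m` consecutive strips that come from one part of `γ` weakly
decrease. (With labels numbered from `0`, the label `p` comes from the part number `p / m`.) -/
structure IsMBorderStripTableau {lam mu : YoungDiagram} (m : ℕ) (γ : List ℕ)
    (T : SkewBox lam mu → Fin (starRepeat m γ).length) : Prop where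
  isBorderStripTableau : IsBorderStripTableau (starRepeat m γ) T
  row_number : ∀ p q : Fin (starRepeat m γ).length, p ≤ q → (p : ℕ) / m = (q : ℕ) / m →
    stripRow (labelBoxes T q) ≤ stripRow (labelBoxes T p)

open Classical in
/-- `a_{λ/μ,γ}`: the sum of the signs of all `m`-border-strip tableaux of shape `λ/μ` and
type `γ`. -/
noncomputable def borderStripSum (m : ℕ) (lam mu : YoungDiagram) (γ : List ℕ) : ℤ :=
  ∑ T : SkewBox lam mu → Fin (starRepeat m γ).length with IsMBorderStripTableau m γ T,
    tableauSign T

/-!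
# Deflations of skew characters and `m`-border-strip tableaux

The deflation of a character `ψ` of `S_m ≀ S_n` is its average over the base group,
`g ↦ (m!)^{-n} ∑_h ψ(h; g)` (`deflation_eq_of_average`). For a Young permutation character
`ξ^α`, Burnside's lemma turns this average into the number of `g`-invariant families of `n` content
vectors of size `m` with sum `α` (`sum_youngPermChar_wreathEmb`). Such a family is constant on the
cycles of `g`, so their number is the coefficient of `x^α` in `∏_i h_m(x^{γ_i})`
(`card_cycle_invariant`). By the determinantal definition of skew characters, the deflation of
`χ^{λ/μ}` at `g` is therefore the coefficient of `x^{λ+δ}` in the product of `∏_i h_m(x^{γ_i})` with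
the alternant of `μ+δ` (`defres_skewChar`, `alternantSum`; positions `λ_a - a` are used in place of
`λ+δ`).

Multiplying the alternant of bead positions `κ` by `h_m(x^r)` gives the sum over all `β ∈ ℕ^l` of
size `m` of the alternants of `κ + rβ`. No cancelling involution is needed to evaluate it. On a
single bead, `∑_m t^m h_m(x^r) = 1/(1 - t x^r)` is the product of the elementary operators
`1 + t E_q`, where `E_q` moves a bead from `q - r` to `q`, applied in order of increasing `q`. On
alternants this says that `β` can be performed as `m` single steps of length `r` with increasing
targets, a step onto an occupied position giving `0` (`restrictedSum_succ`,
`restrictedSum_eq_zero`).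

A step of length `r` on the abacus adds a border strip of length `r`; the row number of the strip is
the row of the moved bead, and sorting the beads gives the sign of the strip (`IsRibbonMove`).
Targets increase exactly when the row numbers weakly decrease (`IsRibbonMove.lt_bead_iff`), so the
steps coming from one part of `γ` are the strips of one block of an `m`-border-strip tableau. Both
sides thus satisfy the same recursion in the first strip (`restrictedSum_eq_tableauSum`,
`alternantSum_eq_tableauSum`).
-/

/-! ### Characters of finite groups and deflation -/

section Characters

open scoped ComplexOrder

variable {G : Type} [Group G] [Fintype G]

/-- The matrix `P = ∑ x, (M x)ᴴ * M x` is positive definite and satisfies `(M g)ᴴ * P * M g = P`,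
so `(M g)ᴴ` is conjugate to `M g⁻¹`. This makes the sesquilinear `charInner` agree with the
bilinear pairing for which Mathlib states orthogonality. -/
theorem star_character (V : Type) [AddCommGroup V] [Module ℂ V] [FiniteDimensional ℂ V]
    (ρ : Representation ℂ G V) (g : G) : star (ρ.character g) = ρ.character g⁻¹ := by
  classical
  let b := Module.finBasis ℂ V
  let M : G → Matrix (Fin (Module.finrank ℂ V)) (Fin (Module.finrank ℂ V)) ℂ :=
    fun x => LinearMap.toMatrix b b (ρ x)
  have hmul : ∀ x y, M (x * y) = M x * M y := fun x y => by
    simp only [M, map_mul, LinearMap.toMatrix_mul]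
  have hone : M 1 = 1 := by simp [M, LinearMap.toMatrix_one]
  have htr : ∀ x, ρ.character x = (M x).trace := fun x => by
    rw [Representation.character, LinearMap.trace_eq_matrix_trace ℂ b]
  let P := ∑ x, (M x).conjTranspose * M x
  have hP : P.PosDef := by
    have h1 : P = 1 + ∑ x ∈ univ.erase 1, (M x).conjTranspose * M x := by
      simp only [P]
      rw [← Finset.add_sum_erase _ _ (mem_univ (1 : G))]
      simp [hone]
    rw [h1]
    refine Matrix.PosDef.one.add_posSemidef ?_
    exact Matrix.posSemidef_sum _ fun x _ => Matrix.posSemidef_conjTranspose_mul_self _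
  have hinv : (M g).conjTranspose * P * M g = P := by
    simp only [P, Finset.mul_sum, Finset.sum_mul]
    refine Fintype.sum_equiv (Equiv.mulRight g) _ _ fun x => ?_
    simp [hmul, Matrix.conjTranspose_mul, Matrix.mul_assoc]
  have hU : IsUnit P.det := (Matrix.isUnit_iff_isUnit_det _).1 hP.isUnit
  have hg : M g * M g⁻¹ = 1 := by rw [← hmul, mul_inv_cancel, hone]
  have h2 : (M g).conjTranspose = P * M g⁻¹ * P⁻¹ := by
    have : (M g).conjTranspose * P = P * M g⁻¹ := by
      calc (M g).conjTranspose * P = (M g).conjTranspose * P * (M g * M g⁻¹) := by rw [hg, mul_one]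
        _ = P * M g⁻¹ := by rw [← Matrix.mul_assoc, hinv]
    rw [← this, Matrix.mul_assoc, Matrix.mul_nonsing_inv _ hU, mul_one]
  rw [htr, htr, ← Matrix.trace_conjTranspose, h2, Matrix.trace_mul_comm, ← Matrix.mul_assoc,
    Matrix.nonsing_inv_mul _ hU, one_mul]

theorem charInner_irreducible {χ ψ : G → ℂ} (hχ : χ ∈ irreducibleCharacters G)
    (hψ : ψ ∈ irreducibleCharacters G) [Decidable (χ = ψ)] :
    charInner χ ψ = if χ = ψ then 1 else 0 := by
  obtain ⟨V, _, _, ρ, _, hρ, rfl⟩ := hχ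
  obtain ⟨W, _, _, σ, _, hσ, rfl⟩ := hψ
  have hc : (Nat.card G : ℂ) ≠ 0 := by simp
  have : Invertible (Nat.card G : ℂ) := invertibleOfNonzero hc
  have key : charInner ρ.character σ.character =
      (Nat.card G : ℂ)⁻¹ * ∑ g : G, ρ.character g * σ.character g⁻¹ := by
    simp [charInner, ← star_character]
  split_ifs with h
  · rw [key, ← h, Representation.char_orthonormal, if_pos ⟨.refl _⟩]
  · rw [key, Representation.char_orthonormal, if_neg]
    rintro ⟨φ⟩
    exact h (Representation.char_iso φ).symm

theorem charInner_sum_left {ι : Type*} (s : Finset ι) (a : ι → ℂ) (f : ι → G → ℂ) (ψ : G → ℂ) :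
    charInner (∑ i ∈ s, a i • f i) ψ = ∑ i ∈ s, a i * charInner (f i) ψ := by
  simp only [charInner, Finset.sum_apply, Pi.smul_apply, smul_eq_mul, Finset.mul_sum,
    Finset.sum_mul]
  rw [Finset.sum_comm]
  exact sum_congr rfl fun i _ => sum_congr rfl fun g _ => by ring

theorem finite_irreducibleCharacters : (irreducibleCharacters G).Finite := by
  classical
  have : LinearIndependent ℂ (Subtype.val : irreducibleCharacters G → G → ℂ) := by
    rw [linearIndependent_iff']
    intro s a ha i hi
    have h := charInner_sum_left s a (fun j => (j : G → ℂ)) i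
    rw [ha, sum_eq_single i] at h
    · rw [charInner_irreducible i.2 i.2, if_pos rfl] at h
      simpa [charInner] using h.symm
    · intro j _ hj
      rw [charInner_irreducible j.2 i.2, if_neg (fun h => hj (Subtype.ext h)), mul_zero]
    · exact fun h => absurd hi h
  exact this.setFinite

omit [Fintype G] in
theorem isIrreducible_ofModule' (M : Type*) [AddCommGroup M] [Module ℂ M]
    [Module (MonoidAlgebra ℂ G) M] [IsScalarTower ℂ (MonoidAlgebra ℂ G) M]
    [IsSimpleModule (MonoidAlgebra ℂ G) M] :
    (Representation.ofModule' (k := ℂ) (G := G) M).IsIrreducible := by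
  have hact : ∀ (g : G) (x : M),
      Representation.ofModule' (k := ℂ) (G := G) M g x = MonoidAlgebra.single g (1 : ℂ) • x :=
    fun g x => by simp [Representation.ofModule']
  have hnt := IsSimpleModule.nontrivial (MonoidAlgebra ℂ G) M
  refine { exists_pair_ne := ⟨⊥, ⊤, fun h => ?_⟩, eq_bot_or_eq_top := fun U => ?_ }
  · obtain ⟨x, hx⟩ := exists_ne (0 : M)
    have : x ∈ (⊤ : Subrepresentation (Representation.ofModule' (k := ℂ) (G := G) M)) := trivial
    rw [← h] at this
    exact hx this
  · let N : Submodule (MonoidAlgebra ℂ G) M :=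
      { carrier := U
        add_mem' := fun hx hy => U.toSubmodule.add_mem hx hy
        zero_mem' := U.toSubmodule.zero_mem
        smul_mem' := fun a x hx => by
          induction a using MonoidAlgebra.induction_on with
          | of g =>
            have := U.apply_mem_toSubmodule g hx
            rw [hact] at this
            exact this
          | add a b ha hb => rw [add_smul]; exact U.toSubmodule.add_mem ha hb
          | smul c a ha => rw [smul_assoc]; exact U.toSubmodule.smul_mem c ha }
    rcases eq_bot_or_eq_top N with h | h
    · left
      ext x
      exact (SetLike.ext_iff.1 h x)
    · right
      ext x
      exact (SetLike.ext_iff.1 h x)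

/-- Completeness of the irreducible characters: the central element `z = ∑ g, f(g) g⁻¹` of the group
algebra acts on a simple module by a scalar (Schur's lemma) of trace zero, hence as zero; since the
group algebra is semisimple, `z = z * 1 = 0`. -/
theorem eq_zero_of_charInner_eq_zero (f : G → ℂ) (hf : ∀ x g, f (x * g * x⁻¹) = f g)
    (h : ∀ χ ∈ irreducibleCharacters G, charInner f χ = 0) : f = 0 := by
  classical
  have act : ∀ (V : Type) [AddCommGroup V] [Module ℂ V] (ρ : Representation ℂ G V)
      [FiniteDimensional ℂ V] [ρ.IsIrreducible], ∑ g, f g • ρ g⁻¹ = 0 := by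
    intro V _ _ ρ _ hρ
    let T : Representation.IntertwiningMap ρ ρ :=
      { toLinearMap := ∑ g, f g • ρ g⁻¹
        isIntertwining' := by
          intro x
          rw [← Module.End.mul_eq_comp, ← Module.End.mul_eq_comp, Finset.sum_mul, Finset.mul_sum]
          refine Fintype.sum_equiv (MulAut.conj x⁻¹).toEquiv _ _ fun g => ?_
          have h1 : f (x⁻¹ * g * x) = f g := by simpa using hf x⁻¹ g
          simp only [MulEquiv.toEquiv_eq_coe, EquivLike.coe_coe, MulAut.conj_apply, inv_inv,
            h1, smul_mul_assoc, mul_smul_comm]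
          congr 1
          rw [← map_mul, ← map_mul]
          congr 1
          group }
    obtain ⟨c, hc⟩ :=
      (Representation.IsIrreducible.algebraMap_intertwiningMap_bijective_of_isAlgClosed
        (ρ := ρ)).2 T
    have hT : ∑ g, f g • ρ g⁻¹ = c • (LinearMap.id : V →ₗ[ℂ] V) := by
      have := congrArg Representation.IntertwiningMap.toLinearMap hc
      exact this.symm
    have htr := congrArg (LinearMap.trace ℂ V) hT
    have h0 := h ρ.character ⟨V, _, _, ρ, inferInstance, hρ, rfl⟩
    have hcard : (Fintype.card G : ℂ)⁻¹ ≠ 0 := by simp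
    rw [charInner, mul_eq_zero, or_iff_right hcard] at h0
    have h0' : ∑ g, f g * LinearMap.trace ℂ V (ρ g⁻¹) = 0 := by
      rw [← h0]
      exact sum_congr rfl fun g _ => by rw [star_character]; rfl
    rw [map_sum] at htr
    simp only [map_smul, smul_eq_mul, LinearMap.trace_id] at htr
    rw [h0'] at htr
    have : Nontrivial V := by
      by_contra hV
      rw [not_nontrivial_iff_subsingleton] at hV
      have : Nontrivial (Subrepresentation ρ) := hρ.toNontrivial
      obtain ⟨a, b, hab⟩ := exists_pair_ne (Subrepresentation ρ)
      apply hab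
      ext v
      rw [Subsingleton.elim v 0]
      exact ⟨fun _ => b.toSubmodule.zero_mem, fun _ => a.toSubmodule.zero_mem⟩
    have hd : (Module.finrank ℂ V : ℂ) ≠ 0 := by
      exact_mod_cast (Module.finrank_pos (R := ℂ) (M := V)).ne'
    have : c = 0 := by
      rcases mul_eq_zero.1 htr.symm with h | h
      · exact h
      · exact absurd h hd
    rw [hT, this, zero_smul]
  let z : MonoidAlgebra ℂ G := ∑ g, MonoidAlgebra.single g⁻¹ (f g)
  have : NeZero (Nat.card G : ℂ) := ⟨by simp⟩
  have hz : ∀ v : MonoidAlgebra ℂ G, z * v = 0 := by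
    intro v
    have hv : v ∈ sSup {S : Submodule (MonoidAlgebra ℂ G) (MonoidAlgebra ℂ G) |
        IsSimpleModule (MonoidAlgebra ℂ G) S} := by
      rw [IsSemisimpleModule.sSup_simples_eq_top]; trivial
    rw [sSup_eq_iSup'] at hv
    refine Submodule.iSup_induction _ (motive := fun v => z * v = 0) hv ?_ (mul_zero _)
      (fun x y hx hy => by rw [mul_add, hx, hy, add_zero])
    rintro ⟨S, hS⟩ x hx
    have : IsSimpleModule (MonoidAlgebra ℂ G) S := hS
    have hirr := isIrreducible_ofModule' (G := G) S
    have : FiniteDimensional ℂ (MonoidAlgebra ℂ G) :=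
      Module.Finite.equiv (MonoidAlgebra.coeffLinearEquiv ℂ).symm
    have : FiniteDimensional ℂ S :=
      FiniteDimensional.of_injective (S.subtype.restrictScalars ℂ) Subtype.val_injective
    have h2 := congrArg (fun T : S →ₗ[ℂ] S => (T ⟨x, hx⟩ : MonoidAlgebra ℂ G))
      (act S (Representation.ofModule' (k := ℂ) (G := G) S))
    simp only [LinearMap.sum_apply, LinearMap.smul_apply, LinearMap.zero_apply,
      AddSubmonoidClass.coe_finsetSum, ZeroMemClass.coe_zero] at h2
    rw [← h2, Finset.sum_mul]
    refine sum_congr rfl fun g _ => ?_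
    have h3 : MonoidAlgebra.single g⁻¹ (f g) = f g • MonoidAlgebra.single g⁻¹ (1 : ℂ) := by simp
    rw [h3, smul_mul_assoc]
    simp [Representation.ofModule']
  have h1 := hz 1
  rw [mul_one] at h1
  funext g
  have h2 := congrArg (fun w : MonoidAlgebra ℂ G => w.coeff g⁻¹) h1
  simpa [z, Finsupp.finsetSum_apply, Finsupp.single_apply] using h2

theorem finsum_charInner_smul (f : G → ℂ) (hf : ∀ x g, f (x * g * x⁻¹) = f g) :
    ∑ᶠ χ ∈ irreducibleCharacters G, charInner f χ • χ = f := by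
  classical
  have hfin := finite_irreducibleCharacters (G := G)
  rw [finsum_mem_eq_finite_toFinset_sum _ hfin]
  symm
  rw [← sub_eq_zero]
  apply eq_zero_of_charInner_eq_zero
  · intro x g
    simp only [Pi.sub_apply, Finset.sum_apply, Pi.smul_apply, hf]
    congr 1
    refine sum_congr rfl fun χ hχ => ?_
    obtain ⟨V, _, _, ρ, _, hρ, rfl⟩ := hfin.mem_toFinset.1 hχ
    rw [Representation.char_conj]
  · intro ψ hψ
    have h1 : charInner (f - ∑ χ ∈ hfin.toFinset, charInner f χ • χ) ψ =
        charInner f ψ - charInner (∑ χ ∈ hfin.toFinset, charInner f χ • χ) ψ := by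
      simp only [charInner, Pi.sub_apply, sub_mul, Finset.sum_sub_distrib, mul_sub]
    rw [h1, charInner_sum_left, sum_eq_single ψ, charInner_irreducible hψ hψ, if_pos rfl, mul_one,
      sub_self]
    · intro χ hχ hne
      rw [charInner_irreducible (hfin.mem_toFinset.1 hχ) hψ, if_neg hne, mul_zero]
    · exact fun h => absurd (hfin.mem_toFinset.2 hψ) h

end Characters

section Deflation

variable {m n : ℕ}

theorem inflation_injective : Function.Injective (inflation (m := m) (n := n)) := by
  intro η η' h
  funext g
  exact congrFun h ⟨1, g⟩

theorem inflation_mem_irreducibleCharacters {η : Perm (Fin n) → ℂ}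
    (hη : η ∈ irreducibleCharacters (Perm (Fin n))) :
    inflation (m := m) η ∈ irreducibleCharacters (WreathSymm m n) := by
  obtain ⟨V, _, _, ρ, hfd, hρ, rfl⟩ := hη
  refine ⟨V, _, _, ρ.comp SemidirectProduct.rightHom, hfd, ?_, rfl⟩
  let toSub (U : Subrepresentation (ρ.comp (SemidirectProduct.rightHom :
      WreathSymm m n →* Perm (Fin n)))) : Subrepresentation ρ :=
    ⟨U.toSubmodule, fun g v hv => U.apply_mem_toSubmodule (⟨1, g⟩ : WreathSymm m n) hv⟩
  obtain ⟨⟨U, U', hU⟩⟩ := hρ.toNontrivial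
  refine { exists_pair_ne := ⟨⟨U.toSubmodule, fun w v hv => U.apply_mem_toSubmodule w.right hv⟩,
      ⟨U'.toSubmodule, fun w v hv => U'.apply_mem_toSubmodule w.right hv⟩, fun h => hU ?_⟩
           eq_bot_or_eq_top := fun U => ?_ }
  · have := congrArg Subrepresentation.toSubmodule h
    exact Subrepresentation.ext this
  · rcases eq_bot_or_eq_top (toSub U) with h | h
    · have := congrArg Subrepresentation.toSubmodule h
      exact Or.inl (Subrepresentation.ext this)
    · have := congrArg Subrepresentation.toSubmodule h
      exact Or.inr (Subrepresentation.ext this)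

theorem deflationIrr_inflation {η : Perm (Fin n) → ℂ}
    (hη : η ∈ irreducibleCharacters (Perm (Fin n))) :
    deflationIrr (inflation (m := m) η) = η := by
  have h : ∃ η' ∈ irreducibleCharacters (Perm (Fin n)), inflation (m := m) η = inflation η' :=
    ⟨η, hη, rfl⟩
  rw [deflationIrr, dif_pos h]
  exact (inflation_injective h.choose_spec.2).symm

theorem charInner_inflation (ψ : WreathSymm m n → ℂ) (a η : Perm (Fin n) → ℂ)
    (ha : ∀ g, ∑ h : Fin n → Perm (Fin m), ψ ⟨h, g⟩ = (m.factorial : ℂ) ^ n * a g) :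
    charInner ψ (inflation η) = charInner a η := by
  have hcard : (Fintype.card (WreathSymm m n) : ℂ) =
      (m.factorial : ℂ) ^ n * Fintype.card (Perm (Fin n)) := by
    rw [Fintype.card_congr SemidirectProduct.equivProd, Fintype.card_prod, Fintype.card_fun,
      Fintype.card_perm, Fintype.card_fin, Fintype.card_fin]
    push_cast
    rfl
  have hsum : ∑ w : WreathSymm m n, ψ w * star (inflation η w) =
      (m.factorial : ℂ) ^ n * ∑ g, a g * star (η g) := by
    rw [Fintype.sum_equiv SemidirectProduct.equivProd
      (fun w : WreathSymm m n => ψ w * star (inflation η w))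
      (fun p : (Fin n → Perm (Fin m)) × Perm (Fin n) => ψ ⟨p.1, p.2⟩ * star (η p.2))
      (fun w => by rfl), Fintype.sum_prod_type_right, Finset.mul_sum]
    refine sum_congr rfl fun g _ => ?_
    simp only [← Finset.sum_mul, ha, mul_assoc]
  have h0 : (m.factorial : ℂ) ^ n ≠ 0 := pow_ne_zero _ (by exact_mod_cast m.factorial_ne_zero)
  rw [charInner, charInner, hsum, hcard, mul_inv, ← mul_assoc]
  field_simp

/-- Deflation is averaging over the cosets of the base group: only inflations of irreducible
characters `η` contribute to the sum defining it, and the coefficient of `inflation η` is the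
coefficient of `η` in the average. -/
theorem deflation_eq_of_average (ψ : WreathSymm m n → ℂ) (a : Perm (Fin n) → ℂ)
    (hclass : ∀ x g, a (x * g * x⁻¹) = a g)
    (ha : ∀ g, ∑ h : Fin n → Perm (Fin m), ψ ⟨h, g⟩ = (m.factorial : ℂ) ^ n * a g) :
    deflation ψ = a := by
  rw [deflation, ← finsum_charInner_smul a hclass,
    finsum_mem_inter_support_eq _ (irreducibleCharacters (WreathSymm m n))
      (inflation '' irreducibleCharacters (Perm (Fin n))),
    finsum_mem_image inflation_injective.injOn]
  · refine finsum_mem_congr rfl fun η hη => ?_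
    rw [deflationIrr_inflation hη, charInner_inflation ψ a η ha]
  · ext ξ
    simp only [Set.mem_inter_iff, Set.mem_image, Function.mem_support]
    refine and_congr_left fun hξ => ⟨fun h => ?_, ?_⟩
    · by_contra hne
      apply hξ
      rw [deflationIrr, dif_neg, smul_zero]
      rintro ⟨η, hη, rfl⟩
      exact hne ⟨η, hη, rfl⟩
    · rintro ⟨η, hη, rfl⟩
      exact inflation_mem_irreducibleCharacters hη

end Deflation

/-! ### Averages of Young permutation characters over the base group -/

section YoungAverage

variable {X : Type*} [Fintype X] {l : ℕ}

/-- The content of a word `u` in the alphabet `Fin l`: the multiplicities of the letters. -/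
def content (u : X → Fin l) : Fin l → ℕ := fun i => #{x | u x = i}

theorem content_mem_piAntidiag (u : X → Fin l) :
    content u ∈ piAntidiag univ (Fintype.card X) := by
  rw [mem_piAntidiag]
  refine ⟨?_, fun i _ => mem_univ i⟩
  change ∑ i, #{x | u x = i} = _
  rw [← card_eq_sum_card_fiberwise (fun x _ => mem_univ _), card_univ]

theorem exists_content_eq {β : Fin l → ℕ} (hβ : β ∈ piAntidiag univ (Fintype.card X)) :
    ∃ u : X → Fin l, content u = β := by
  classical
  rw [mem_piAntidiag] at hβ
  have hcard : Fintype.card X = Fintype.card (Σ i, Fin (β i)) := by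
    simp only [Fintype.card_sigma, Fintype.card_fin]
    exact hβ.1.symm
  let e := Fintype.equivOfCardEq hcard
  refine ⟨fun x => (e x).1, funext fun i => ?_⟩
  have h1 : #{x | (e x).1 = i} = #{y : Σ i, Fin (β i) | y.1 = i} :=
    card_equiv e (by simp)
  have h2 : ({y | y.1 = i} : Finset (Σ i, Fin (β i))) =
      univ.map (Function.Embedding.sigmaMk (β := fun i => Fin (β i)) i) := by
    ext ⟨j, b⟩
    simp only [mem_filter, mem_univ, true_and, mem_map, Function.Embedding.sigmaMk_apply]
    constructor
    · rintro rfl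
      exact ⟨b, rfl⟩
    · rintro ⟨c, hc⟩
      exact (congrArg Sigma.fst hc).symm
  rw [content, h1, h2, card_map, card_univ, Fintype.card_fin]

theorem exists_comp_perm_eq {u v : X → Fin l} (h : content u = content v) :
    ∃ τ : Perm X, u ∘ τ = v := by
  have e : ∀ c, {x // v x = c} ≃ {x // u x = c} := fun c =>
    Fintype.equivOfCardEq (by
      rw [Fintype.card_subtype, Fintype.card_subtype]
      exact (congrFun h c).symm)
  exact ⟨Equiv.ofFiberEquiv e, funext fun x => Equiv.ofFiberEquiv_map e x⟩

theorem content_comp_perm (u : X → Fin l) (τ : Perm X) : content (u ∘ τ) = content u :=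
  funext fun i => card_equiv τ (by simp)

variable [DecidableEq X]

/-- Orbit–stabiliser for the action of `S_X` on the words of a given content. -/
theorem card_comp_eq_mul (u v : X → Fin l) (h : content u = content v) :
    #{σ : Perm X | u ∘ σ = v} * #{w : X → Fin l | content w = content u} =
      (Fintype.card X).factorial := by
  have h1 : ∀ w : X → Fin l, content w = content u →
      #{σ : Perm X | u ∘ σ = w} = #{σ : Perm X | u ∘ σ = u} := by
    intro w hw
    obtain ⟨τ, rfl⟩ := exists_comp_perm_eq hw.symm
    refine card_equiv (Equiv.mulRight τ⁻¹) fun σ => ?_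
    simp only [mem_filter_univ, Equiv.coe_mulRight, Perm.coe_mul]
    constructor
    · intro hσ
      rw [← Function.comp_assoc, hσ, Function.comp_assoc, ← Perm.coe_mul]; simp
    · intro hσ
      conv_rhs => rw [← hσ]
      rw [Function.comp_assoc, Function.comp_assoc, ← Perm.coe_mul]; simp
  rw [← Fintype.card_perm, ← card_univ (α := Perm X),
    card_eq_sum_card_fiberwise (s := univ) (f := fun σ : Perm X => u ∘ σ)
      (t := {w : X → Fin l | content w = content u})
      (fun σ _ => by simp [content_comp_perm]), sum_congr rfl fun w hw => h1 w (by simpa using hw),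
    sum_const, smul_eq_mul, h1 v h.symm, mul_comm]

theorem card_comp_eq (u v : X → Fin l) :
    #{σ : Perm X | u ∘ σ = v} = if content u = content v then
      (Fintype.card X).factorial / #{w : X → Fin l | content w = content u} else 0 := by
  split_ifs with h
  · rw [← card_comp_eq_mul u v h, Nat.mul_div_cancel]
    exact card_pos.2 ⟨u, by simp⟩
  · rw [card_eq_zero, filter_eq_empty_iff]
    rintro σ - rfl
    exact h (content_comp_perm u σ).symm

theorem card_content_mul {β : Fin l → ℕ} (hβ : β ∈ piAntidiag univ (Fintype.card X)) :
    #{w : X → Fin l | content w = β} *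
      ((Fintype.card X).factorial / #{w : X → Fin l | content w = β}) =
      (Fintype.card X).factorial := by
  obtain ⟨u, rfl⟩ := exists_content_eq hβ
  exact Nat.mul_div_cancel' ⟨_, (card_comp_eq_mul u u rfl).symm.trans (mul_comm _ _)⟩

end YoungAverage

section YoungCharacter

variable {l : ℕ}

/-- Burnside's lemma for a coset `S_m^n g`: the average over the base group of the number of fixed
points is the number of `g`-invariant orbits of the base group. An orbit is the family `B` of the
contents of the `n` blocks. -/
theorem sum_youngPermChar_wreathEmb (m n : ℕ) (α : Fin l → ℤ) (g : Perm (Fin n)) :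
    ∑ h : Fin n → Perm (Fin m), youngPermChar α (wreathEmb m n ⟨h, g⟩) =
      (m.factorial : ℤ) ^ n *
        #{B ∈ Fintype.piFinset (fun _ : Fin n => piAntidiag (univ : Finset (Fin l)) m) |
          (∀ j, B (g j) = B j) ∧ ∀ i, (∑ j, (B j i : ℤ)) = α i} := by
  classical
  let M : Finset (Fin l → ℕ) := piAntidiag univ m
  let cls : (Fin l → ℕ) → ℕ := fun β => #{w : Fin m → Fin l | content w = β}
  let K : (Fin l → ℕ) → ℕ := fun β => m.factorial / cls β
  let u : (Fin m × Fin n → Fin l) → Fin n → Fin m → Fin l := fun f j a => f (a, j)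
  -- the orbit given by `B` is `g`-invariant and has total content `α`
  let P : (Fin n → Fin l → ℕ) → Prop := fun B =>
    (∀ j, B (g j) = B j) ∧ ∀ i, (∑ j, (B j i : ℤ)) = α i
  have hM : ∀ w : Fin m → Fin l, content w ∈ M := fun w => by
    have := content_mem_piAntidiag w
    rwa [Fintype.card_fin] at this
  have hcont : ∀ (f : Fin m × Fin n → Fin l) (i : Fin l),
      (#{x | f x = i} : ℤ) = ∑ j, (content (u f j) i : ℤ) := by
    intro f i
    norm_cast
    rw [card_eq_sum_card_fiberwise (f := Prod.snd) (t := univ) (fun x _ => mem_univ _)]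
    refine sum_congr rfl fun j _ => ?_
    symm
    refine card_bij (fun a _ => (a, j)) (by simp [u]) (by simp) ?_
    rintro ⟨a, j'⟩ h
    simp only [mem_filter, mem_univ, true_and] at h
    obtain ⟨h1, rfl⟩ := h
    exact ⟨a, by simpa [u] using h1, rfl⟩
  -- the number of base group elements fixing a given function
  have hfix : ∀ f : Fin m × Fin n → Fin l,
      #{h : Fin n → Perm (Fin m) | ∀ x, f (wreathEmb m n ⟨h, g⟩ x) = f x} =
        if ∀ j, content (u f (g j)) = content (u f j) then ∏ j, K (content (u f j)) else 0 := by
    intro f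
    have h1 : ({h : Fin n → Perm (Fin m) | ∀ x, f (wreathEmb m n ⟨h, g⟩ x) = f x} : Finset _) =
        Fintype.piFinset fun k => {σ : Perm (Fin m) | u f k ∘ σ = u f (g⁻¹ k)} := by
      ext h
      simp only [mem_filter, mem_univ, true_and, Fintype.mem_piFinset, funext_iff, Prod.forall]
      constructor
      · intro H k a
        have := H a (g⁻¹ k)
        simpa [wreathEmb, u] using this
      · intro H a j
        have := H (g j) a
        simpa [wreathEmb, u] using this
    rw [h1, Fintype.card_piFinset]
    simp only [card_comp_eq, Fintype.card_fin]
    have h2 : (∀ j, content (u f (g j)) = content (u f j)) ↔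
        ∀ k ∈ univ, content (u f k) = content (u f (g⁻¹ k)) :=
      ⟨fun H k _ => by simpa using H (g⁻¹ k), fun H j => by simpa using H (g j) (mem_univ _)⟩
    rw [prod_ite_zero]
    split_ifs with a b b
    · rfl
    · exact absurd (h2.2 a) b
    · exact absurd (h2.1 b) a
    · rfl
  have hcls : ∀ B : Fin n → Fin l → ℕ,
      #{f : Fin m × Fin n → Fin l | (fun j => content (u f j)) = B} = ∏ j, cls (B j) := by
    intro B
    rw [← Fintype.card_piFinset]
    refine card_equiv ((Equiv.prodComm _ _).arrowCongr (Equiv.refl _) |>.trans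
      (Equiv.curry _ _ _)) fun f => ?_
    simp only [mem_filter, mem_univ, true_and, Fintype.mem_piFinset, funext_iff]
    rfl
  calc ∑ h : Fin n → Perm (Fin m), youngPermChar α (wreathEmb m n ⟨h, g⟩)
      = ∑ f : Fin m × Fin n → Fin l, if ∀ i, (#{x | f x = i} : ℤ) = α i then
          (#{h : Fin n → Perm (Fin m) | ∀ x, f (wreathEmb m n ⟨h, g⟩ x) = f x} : ℤ) else 0 := by
        simp only [youngPermChar, card_filter, Nat.cast_sum, Nat.cast_ite, Nat.cast_one,
          Nat.cast_zero]
        rw [sum_comm]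
        refine sum_congr rfl fun f _ => ?_
        split_ifs with h
        · exact sum_congr rfl fun σ _ => if_congr (and_iff_left h) rfl rfl
        · exact sum_eq_zero fun σ _ => if_neg fun h' => h h'.2
    _ = ∑ f : Fin m × Fin n → Fin l, if P (fun j => content (u f j)) then
          ((∏ j, K (content (u f j)) : ℕ) : ℤ) else 0 := by
        refine sum_congr rfl fun f _ => ?_
        rw [hfix]
        simp only [hcont, P]
        split_ifs <;> simp_all
    _ = ∑ B ∈ Fintype.piFinset (fun _ : Fin n => M), if P B then
          ((∏ j, cls (B j) : ℕ) : ℤ) * ((∏ j, K (B j) : ℕ) : ℤ) else 0 := by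
        rw [← sum_fiberwise_of_maps_to (g := fun f j => content (u f j))
          (t := Fintype.piFinset (fun _ : Fin n => M))
          (fun f _ => Fintype.mem_piFinset.2 fun j => hM _)]
        refine sum_congr rfl fun B _ => ?_
        rw [← hcls, sum_congr rfl (g := fun _ => if P B then ((∏ j, K (B j) : ℕ) : ℤ) else 0)]
        · rw [sum_const]
          split_ifs <;> simp
        · intro f hf
          rw [← (mem_filter.1 hf).2]
    _ = ∑ B ∈ Fintype.piFinset (fun _ : Fin n => M), if P B then (m.factorial : ℤ) ^ n else 0 := by
        refine sum_congr rfl fun B hB => ?_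
        have : (∏ j, cls (B j)) * (∏ j, K (B j)) = m.factorial ^ n := by
          rw [← prod_mul_distrib, prod_congr rfl (g := fun _ => m.factorial)]
          · simp
          · intro j _
            have := card_content_mul (X := Fin m) (β := B j)
              (by rw [Fintype.card_fin]; exact Fintype.mem_piFinset.1 hB j)
            simpa using this
        norm_cast
        rw [this]
    _ = _ := by
        rw [← sum_filter, sum_const, nsmul_eq_mul, mul_comm]

end YoungCharacter

/-! ### Invariant families as coefficients of a symmetric polynomial -/

section CycleProduct

variable {l : ℕ}

/-- The plethysm `p_c ∘ h_m` in `l` variables: the complete homogeneous symmetric polynomial of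
degree `m` in the `c`-th powers of the variables. Exponents are allowed to be negative integers, so
that coefficients can be extracted at arbitrary vectors of `Fin l → ℤ`. -/
noncomputable def completeSymm (m l c : ℕ) : AddMonoidAlgebra ℤ (Fin l → ℤ) :=
  ∑ β ∈ piAntidiag (univ : Finset (Fin l)) m, AddMonoidAlgebra.single (fun i => (c : ℤ) * β i) 1

theorem coeff_prod_completeSymm (m : ℕ) {Ω : Type*} [Fintype Ω] [DecidableEq Ω] (c : Ω → ℕ)
    (α : Fin l → ℤ) :
    (∏ ω, completeSymm m l (c ω)).coeff α =
      #{b ∈ Fintype.piFinset (fun _ : Ω => piAntidiag (univ : Finset (Fin l)) m) |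
        ∀ i, (∑ ω, (c ω : ℤ) * b ω i) = α i} := by
  simp only [completeSymm]
  rw [prod_univ_sum, AddMonoidAlgebra.coeff_sum, Finsupp.finsetSum_apply, card_filter]
  push_cast
  refine sum_congr rfl fun b _ => ?_
  rw [AddMonoidAlgebra.prod_single, prod_const_one, AddMonoidAlgebra.coeff_single,
    Finsupp.single_apply]
  exact if_congr (by simp [funext_iff]) rfl rfl

theorem coeff_completeSymm_mul (m c : ℕ) (P : AddMonoidAlgebra ℤ (Fin l → ℤ)) (α : Fin l → ℤ) :
    (completeSymm m l c * P).coeff α =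
      ∑ β ∈ piAntidiag (univ : Finset (Fin l)) m, P.coeff (fun i => α i - c * β i) := by
  rw [completeSymm, Finset.sum_mul, AddMonoidAlgebra.coeff_sum, Finsupp.finsetSum_apply]
  refine sum_congr rfl fun β _ => ?_
  have h : α = (fun i => (c : ℤ) * β i) + fun i => α i - c * β i := by
    funext i; simp
  conv_lhs => rw [h, AddMonoidAlgebra.coeff_single_mul_add, one_mul]

variable {X : Type*} [Fintype X]

theorem apply_eq_of_sameCycle {Y : Type*} {g : Perm X} {B : X → Y} (hB : ∀ x, B (g x) = B x)
    {x y : X} (h : g.SameCycle x y) : B x = B y := by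
  obtain ⟨k, -, rfl⟩ := h.exists_pow_eq'
  induction k with
  | zero => rfl
  | succ k ih => rw [pow_succ', Perm.mul_apply, hB, ← ih ⟨k, by simp⟩]

variable [DecidableEq X]

/-- The index of the cycle of `g` (possibly a fixed point) that contains `x`. -/
def cycleIndex (g : Perm X) (x : X) : g.cycleFactorsFinset ⊕ {x : X // g x = x} :=
  if h : g x = x then Sum.inr ⟨x, h⟩
  else Sum.inl ⟨g.cycleOf x, Perm.cycleOf_mem_cycleFactorsFinset_iff.2 (Perm.mem_support.2 h)⟩

/-- The length of the cycle with a given index. -/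
def cycleLength (g : Perm X) : g.cycleFactorsFinset ⊕ {x : X // g x = x} → ℕ :=
  Sum.elim (fun c => #c.1.support) fun _ => 1

theorem cycleIndex_eq_inl {g : Perm X} {c : g.cycleFactorsFinset} {x : X} :
    cycleIndex g x = Sum.inl c ↔ x ∈ c.1.support := by
  rw [cycleIndex]
  split_ifs with h
  · simp only [false_iff]
    intro hx
    exact Perm.mem_support.1 (Perm.mem_cycleFactorsFinset_support_le c.2 hx) h
  · rw [Sum.inl.injEq, Subtype.ext_iff]
    constructor
    · rintro h'
      rw [← h']
      exact Perm.mem_support_cycleOf_iff.2 ⟨.refl _ _, Perm.mem_support.2 h⟩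
    · intro hx
      exact (Perm.cycle_is_cycleOf hx c.2).symm

theorem cycleIndex_eq_inr {g : Perm X} {y : {x : X // g x = x}} {x : X} :
    cycleIndex g x = Sum.inr y ↔ x = y := by
  rw [cycleIndex]
  split_ifs with h
  · rw [Sum.inr.injEq, Subtype.ext_iff]
  · simp only [false_iff]
    rintro rfl
    exact h y.2

theorem card_cycleIndex_fiber (g : Perm X) (ω : g.cycleFactorsFinset ⊕ {x : X // g x = x}) :
    #{x | cycleIndex g x = ω} = cycleLength g ω := by
  rcases ω with c | y
  · simp only [cycleIndex_eq_inl, cycleLength, Sum.elim_inl]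
    congr 1
    ext; simp
  · simp only [cycleIndex_eq_inr, cycleLength, Sum.elim_inr]
    rw [card_eq_one]
    exact ⟨y, by ext; simp⟩

theorem cycleIndex_surjective (g : Perm X) : Function.Surjective (cycleIndex g) := by
  intro ω
  have h : 0 < #{x | cycleIndex g x = ω} := by
    rw [card_cycleIndex_fiber]
    rcases ω with c | y
    · have := (Perm.mem_cycleFactorsFinset_iff.1 c.2).1
      simpa [cycleLength, card_pos, nonempty_iff_ne_empty] using this.ne_one
    · simp [cycleLength]
  obtain ⟨x, hx⟩ := card_pos.1 h
  exact ⟨x, by simpa using hx⟩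

theorem cycleIndex_eq_iff {g : Perm X} {x y : X} :
    cycleIndex g x = cycleIndex g y ↔ g.SameCycle x y := by
  constructor
  · intro h
    rcases hy : cycleIndex g y with c | z
    · rw [hy] at h
      have h1 := Perm.cycle_is_cycleOf (cycleIndex_eq_inl.1 h) c.2
      have h2 := cycleIndex_eq_inl.1 hy
      rw [h1] at h2
      exact (Perm.mem_support_cycleOf_iff.1 h2).1
    · rw [hy] at h
      rw [cycleIndex_eq_inr.1 h, cycleIndex_eq_inr.1 hy]
  · intro h
    refine apply_eq_of_sameCycle (fun x => ?_) h
    rcases hx : cycleIndex g x with c | z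
    · rw [cycleIndex_eq_inl] at hx ⊢
      have := (Perm.mem_cycleFactorsFinset_iff.1 c.2).2 x hx
      rw [← this]
      exact Perm.apply_mem_support.2 hx
    · rw [cycleIndex_eq_inr] at hx ⊢
      rw [hx, z.2]

theorem prod_cycleLength {R : Type*} [CommMonoid R] (g : Perm X) (f : ℕ → R) :
    ∏ ω, f (cycleLength g ω) = (g.partition.parts.map f).prod := by
  rw [Fintype.prod_sum_type, Perm.parts_partition, Multiset.map_add, Multiset.prod_add,
    Multiset.map_replicate, Multiset.prod_replicate]
  simp only [cycleLength, Sum.elim_inl, Sum.elim_inr, prod_const]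
  congr 1
  · rw [Perm.cycleType_def, Multiset.map_map]
    exact prod_coe_sort g.cycleFactorsFinset fun c => f #c.support
  · rw [card_univ, Fintype.card_subtype]
    congr 1
    rw [← card_compl]
    congr 1
    ext x
    simp

/-- A `g`-invariant family is a choice of one content vector for each cycle, weighted by the length
of the cycle. -/
theorem card_cycle_invariant (m : ℕ) (g : Perm X) (α : Fin l → ℤ) :
    (#{B ∈ Fintype.piFinset (fun _ : X => piAntidiag (univ : Finset (Fin l)) m) |
          (∀ j, B (g j) = B j) ∧ ∀ i, (∑ j, (B j i : ℤ)) = α i} : ℤ) =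
      ((g.partition.parts.map (completeSymm m l)).prod).coeff α := by
  rw [← prod_cycleLength, coeff_prod_completeSymm]
  rw [Nat.cast_inj]
  symm
  have hsum : ∀ (b : g.cycleFactorsFinset ⊕ {x : X // g x = x} → Fin l → ℕ) (i : Fin l),
      ∑ j, (b (cycleIndex g j) i : ℤ) = ∑ ω, (cycleLength g ω : ℤ) * b ω i := by
    intro b i
    rw [← sum_fiberwise univ (cycleIndex g)]
    refine sum_congr rfl fun ω _ => ?_
    rw [sum_congr rfl (g := fun _ => (b ω i : ℤ)), sum_const, card_cycleIndex_fiber, nsmul_eq_mul]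
    intro j hj
    rw [(mem_filter.1 hj).2]
  refine card_bij (fun b _ => b ∘ cycleIndex g) ?_ ?_ ?_
  · intro b hb
    simp only [mem_filter, Fintype.mem_piFinset] at hb ⊢
    refine ⟨fun j => hb.1 _, fun j => ?_, fun i => ?_⟩
    · exact congrArg b (cycleIndex_eq_iff.2 (Perm.sameCycle_apply_left.2 (.refl _ _)))
    · rw [← hb.2 i, ← hsum]
      rfl
  · intro b _ b' _ h
    exact (cycleIndex_surjective g).injective_comp_right h
  · intro B hB
    simp only [mem_filter, Fintype.mem_piFinset] at hB
    obtain ⟨s, hs⟩ := (cycleIndex_surjective g).hasRightInverse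
    have hBs : (B ∘ s) ∘ cycleIndex g = B := by
      funext j
      exact apply_eq_of_sameCycle hB.2.1 (cycleIndex_eq_iff.1 (hs _))
    refine ⟨B ∘ s, ?_, hBs⟩
    simp only [mem_filter, Fintype.mem_piFinset]
    refine ⟨fun ω => hB.1 _, fun i => ?_⟩
    rw [← hsum, ← hB.2.2 i]
    exact sum_congr rfl fun j _ => by rw [← congrFun hBs j]; rfl

end CycleProduct

section Defres

/-- The alternating sum over `π` of the coefficients of `x ^ (τ - κ ∘ π)` in
`∏_{r ∈ γ} h_m(x_1^r, …, x_l^r)`, that is, the coefficient of `x ^ τ` in the product of this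
symmetric polynomial with the alternant `∑_π sgn(π) x ^ (κ ∘ π)`. -/
noncomputable def alternantSum {l : ℕ} (m : ℕ) (τ : Fin l → ℤ) (γ : Multiset ℕ) (κ : Fin l → ℤ) :
    ℤ :=
  ∑ π : Perm (Fin l), (Perm.sign π : ℤ) *
    ((γ.map (completeSymm m l)).prod).coeff fun i => τ i - κ (π i)

theorem defres_skewChar (m n : ℕ) (lam mu : YoungDiagram) (g : Perm (Fin n)) :
    defres (fun σ : Perm (Fin m × Fin n) => (skewChar lam mu σ : ℂ)) g =
      (alternantSum m (fun i : Fin (lam.colLen 0) => (lam.rowLen i : ℤ) - (i : ℕ))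
        g.partition.parts (fun i => (mu.rowLen i : ℤ) - (i : ℕ)) : ℤ) := by
  rw [defres, deflation_eq_of_average _ (fun g => (alternantSum m
    (fun i : Fin (lam.colLen 0) => (lam.rowLen i : ℤ) - (i : ℕ))
        g.partition.parts (fun i => (mu.rowLen i : ℤ) - (i : ℕ)) : ℤ))]
  · intro x g
    have h : (x * g * x⁻¹).partition = g.partition :=
      Perm.partition_eq_of_isConj.1 (isConj_iff.2 ⟨x, rfl⟩).symm
    rw [h]
  · intro g
    have key : ∑ h : Fin n → Perm (Fin m), skewChar lam mu (wreathEmb m n ⟨h, g⟩) =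
        (m.factorial : ℤ) ^ n * alternantSum m
          (fun i : Fin (lam.colLen 0) => (lam.rowLen i : ℤ) - (i : ℕ))
          g.partition.parts (fun i => (mu.rowLen i : ℤ) - (i : ℕ)) := ?_
    · simpa using congrArg (Int.cast : ℤ → ℂ) key
    simp only [skewChar, alternantSum]
    rw [sum_comm, Finset.mul_sum]
    refine sum_congr rfl fun π _ => ?_
    rw [← Finset.mul_sum, sum_youngPermChar_wreathEmb, mul_left_comm]
    congr 2
    convert card_cycle_invariant m g _

end Defres

/-! ### Multiplication of alternants by `p_r ∘ h_m` -/

section Alternants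

variable {l : ℕ}

theorem alternantSum_comp_perm (m : ℕ) (τ : Fin l → ℤ) (γ : Multiset ℕ) (κ : Fin l → ℤ)
    (ρ : Perm (Fin l)) :
    alternantSum m τ γ (κ ∘ ρ) = Perm.sign ρ * alternantSum m τ γ κ := by
  rw [alternantSum, alternantSum, Finset.mul_sum]
  refine Fintype.sum_equiv (Equiv.mulLeft ρ) _ _ fun π => ?_
  rw [Equiv.coe_mulLeft, Perm.sign_mul, Units.val_mul, ← mul_assoc, ← mul_assoc,
    ← Units.val_mul, Int.units_mul_self, Units.val_one, one_mul]
  rfl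

theorem alternantSum_cons (m : ℕ) (τ : Fin l → ℤ) (r : ℕ) (γ : Multiset ℕ) (κ : Fin l → ℤ) :
    alternantSum m τ (r ::ₘ γ) κ =
      ∑ β ∈ piAntidiag (univ : Finset (Fin l)) m,
        alternantSum m τ γ (fun i => κ i + r * β i) := by
  simp only [alternantSum, Multiset.map_cons, Multiset.prod_cons, coeff_completeSymm_mul]
  rw [sum_comm]
  refine sum_congr rfl fun π _ => ?_
  rw [← Finset.mul_sum]
  congr 1
  refine sum_bij' (fun β _ => β ∘ π.symm) (fun β _ => β ∘ π) ?_ ?_ ?_ ?_ ?_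
  · intro β hβ
    rw [mem_piAntidiag] at hβ ⊢
    exact ⟨(Equiv.sum_comp π.symm β).trans hβ.1, by simp⟩
  · intro β hβ
    rw [mem_piAntidiag] at hβ ⊢
    exact ⟨(Equiv.sum_comp π β).trans hβ.1, by simp⟩
  · intro β _; funext i; simp
  · intro β _; funext i; simp
  · intro β _
    congr 1
    funext i
    simp only [Function.comp_apply, Equiv.symm_apply_apply]
    ring

theorem alternantSum_zero (m : ℕ) {τ κ : Fin l → ℤ} (hτ : StrictAnti τ) (hκ : StrictAnti κ)
    [Decidable (κ = τ)] : alternantSum m τ 0 κ = if κ = τ then 1 else 0 := by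
  have hcoeff : ∀ π : Perm (Fin l), (((0 : Multiset ℕ).map (completeSymm m l)).prod).coeff
      (fun i => τ i - κ (π i)) = if κ ∘ π = τ then 1 else 0 := by
    intro π
    rw [Multiset.map_zero, Multiset.prod_zero, AddMonoidAlgebra.one_def,
      AddMonoidAlgebra.coeff_single, Finsupp.single_apply]
    refine if_congr ?_ rfl rfl
    simp only [funext_iff, Pi.zero_apply, Function.comp_apply]
    exact forall_congr' fun i => by omega
  simp only [alternantSum, hcoeff]
  have hrange : ∀ π : Perm (Fin l), κ ∘ π = τ → κ = τ := by
    intro π h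
    refine hκ.range_inj hτ |>.1 ?_
    rw [← h, Set.range_comp, π.surjective.range_eq, Set.image_univ]
  split_ifs with h
  · rw [sum_eq_single 1]
    · simp [h]
    · intro π _ hπ
      rw [if_neg, mul_zero]
      intro h'
      apply hπ
      ext i
      have := congrFun (h'.trans h.symm) i
      exact congrArg Fin.val (hκ.injective this)
    · simp
  · exact sum_eq_zero fun π _ => by rw [if_neg (fun h' => h (hrange π h')), mul_zero]

/-- The sum of `f (κ + r β)` over the `β ∈ ℕ^l` of size `m`, where the bead at `κ i` may be moved
(by steps of length `r`) only if its first target `κ i + r` is at least `q`. -/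
def restrictedSum (f : (Fin l → ℤ) → ℤ) (r : ℕ) (q : ℤ) (m : ℕ) (κ : Fin l → ℤ) : ℤ :=
  ∑ β ∈ piAntidiag (univ : Finset (Fin l)) m with ∀ i, κ i + r < q → β i = 0,
    f fun i => κ i + r * β i

theorem restrictedSum_zero (f : (Fin l → ℤ) → ℤ) (r : ℕ) (q : ℤ) (κ : Fin l → ℤ) :
    restrictedSum f r q 0 κ = f κ := by
  rw [restrictedSum, piAntidiag_zero]
  simp [filter_singleton]

theorem restrictedSum_of_forall_le (f : (Fin l → ℤ) → ℤ) (r : ℕ) (q : ℤ) (m : ℕ) (κ : Fin l → ℤ)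
    (h : ∀ i, q ≤ κ i + r) :
    restrictedSum f r q m κ =
      ∑ β ∈ piAntidiag (univ : Finset (Fin l)) m, f fun i => κ i + r * β i := by
  rw [restrictedSum, filter_true_of_mem]
  intro β _ i hi
  exact absurd hi (not_lt.2 (h i))

variable {f : (Fin l → ℤ) → ℤ}

theorem restrictedSum_comp_perm (hf : ∀ κ (ρ : Perm (Fin l)), f (κ ∘ ρ) = Perm.sign ρ * f κ)
    (r : ℕ) (q : ℤ) (m : ℕ) (κ : Fin l → ℤ) (ρ : Perm (Fin l)) :
    restrictedSum f r q m (κ ∘ ρ) = Perm.sign ρ * restrictedSum f r q m κ := by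
  rw [restrictedSum, restrictedSum, Finset.mul_sum]
  refine sum_bij' (fun β _ => β ∘ ρ.symm) (fun β _ => β ∘ ρ) ?_ ?_ ?_ ?_ ?_
  · intro β hβ
    simp only [mem_filter, mem_piAntidiag] at hβ ⊢
    refine ⟨⟨(Equiv.sum_comp ρ.symm β).trans hβ.1.1, by simp⟩, fun i hi => ?_⟩
    exact hβ.2 (ρ.symm i) (by simpa using hi)
  · intro β hβ
    simp only [mem_filter, mem_piAntidiag] at hβ ⊢
    exact ⟨⟨(Equiv.sum_comp ρ β).trans hβ.1.1, by simp⟩, fun i hi => hβ.2 (ρ i) hi⟩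
  · intro β _; funext i; simp
  · intro β _; funext i; simp
  · intro β _
    rw [← hf]
    congr 1
    funext i
    simp

theorem restrictedSum_eq_zero (hf : ∀ κ (ρ : Perm (Fin l)), f (κ ∘ ρ) = Perm.sign ρ * f κ)
    (r : ℕ) (q : ℤ) (m : ℕ) {κ : Fin l → ℤ} {i j : Fin l} (hij : i ≠ j) (h : κ i = κ j) :
    restrictedSum f r q m κ = 0 := by
  have hκ : κ ∘ swap i j = κ := by
    funext k
    rw [Function.comp_apply, swap_apply_def]
    split_ifs with h1 h2
    · rw [h1, h]
    · rw [h2, h]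
    · rfl
  have := restrictedSum_comp_perm hf r q m κ (swap i j)
  rw [hκ, Perm.sign_swap hij] at this
  simp only [Units.val_neg, Units.val_one, neg_mul, one_mul] at this
  omega

/-- Moving the beads one step at a time, with increasing targets: the first bead to be moved is the
lowest one that moves at all, and after its first step all later targets lie above its new
position. Terms in which the bead lands on another one are not excluded here; they vanish when `f`
is alternating, by `restrictedSum_eq_zero`. -/
theorem restrictedSum_succ (f : (Fin l → ℤ) → ℤ) {r : ℕ} (hr : 0 < r) (q : ℤ) (m : ℕ)
    {κ : Fin l → ℤ} (hκ : Function.Injective κ) :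
    restrictedSum f r q (m + 1) κ =
      ∑ i with q ≤ κ i + r,
        restrictedSum f r (κ i + r + 1) m (Function.update κ i (κ i + r)) := by
  simp only [restrictedSum]
  rw [Finset.sum_sigma']
  symm
  refine sum_bij (fun p _ => p.2 + Pi.single p.1 1) ?_ ?_ ?_ ?_
  · rintro ⟨i, β⟩ hp
    simp only [mem_sigma, mem_filter, mem_univ, true_and, mem_piAntidiag] at hp ⊢
    obtain ⟨hi, ⟨hβ, -⟩, hz⟩ := hp
    refine ⟨⟨?_, by simp⟩, fun k hk => ?_⟩
    · simp only [Pi.add_apply]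
      rw [sum_add_distrib, hβ]
      simp
    · have hki : k ≠ i := by rintro rfl; omega
      have := hz k (by rw [Function.update_of_ne hki]; omega)
      simp [this, hki]
  · rintro ⟨i, β⟩ hp ⟨k, β'⟩ hp' h
    simp only [mem_sigma, mem_filter, mem_univ, true_and, mem_piAntidiag] at hp hp' h
    have hik : i = k := by
      by_contra hne
      have h1 := congrFun h i
      have h2 := congrFun h k
      simp only [Pi.add_apply, Pi.single_eq_same, Pi.single_eq_of_ne hne,
        Pi.single_eq_of_ne (Ne.symm hne)] at h1 h2
      have h3 := hp.2.2 k
      have h4 := hp'.2.2 i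
      rw [Function.update_of_ne (Ne.symm hne)] at h3
      rw [Function.update_of_ne hne] at h4
      have h5 : ¬ κ k + r < κ i + r + 1 := fun h => by have := h3 h; omega
      have h6 : ¬ κ i + r < κ k + r + 1 := fun h => by have := h4 h; omega
      omega
    subst hik
    rw [add_right_cancel h]
  · intro β hβ
    simp only [mem_filter, mem_piAntidiag, mem_univ, implies_true, and_true] at hβ
    have hne : (univ.filter fun i => β i ≠ 0).Nonempty := by
      by_contra h
      rw [not_nonempty_iff_eq_empty, filter_eq_empty_iff] at h
      have : univ.sum β = 0 := sum_eq_zero fun i hi => not_not.1 (h hi)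
      omega
    -- the first bead to be moved
    obtain ⟨i, hi, hmin⟩ := exists_min_image _ κ hne
    simp only [mem_filter, mem_univ, true_and] at hi hmin
    have hdec : β - Pi.single i 1 + Pi.single i 1 = β := by
      funext k
      by_cases hk : k = i
      · subst hk
        simp only [Pi.add_apply, Pi.sub_apply, Pi.single_eq_same]
        omega
      · simp [hk]
    refine ⟨⟨i, β - Pi.single i 1⟩, ?_, hdec⟩
    simp only [mem_sigma, mem_filter, mem_univ, true_and, mem_piAntidiag]
    refine ⟨?_, ⟨?_, by simp⟩, fun k hk => ?_⟩
    · by_contra h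
      exact hi (hβ.2 i (by omega))
    · have h1 := hβ.1
      rw [← hdec] at h1
      simp only [Pi.add_apply] at h1
      rw [sum_add_distrib, sum_pi_single'] at h1
      simpa using h1
    · by_cases hki : k = i
      · subst hki
        rw [Function.update_self] at hk
        omega
      · rw [Function.update_of_ne hki] at hk
        have hne' := hκ.ne hki
        have : β k = 0 := by
          by_contra h
          have := hmin k h
          omega
        simp [this]
  · rintro ⟨i, β⟩ hp
    congr 1
    funext k
    by_cases hki : k = i
    · subst hki
      simp
      ring
    · simp [hki]

end Alternants

/-! ### Border strips and bead moves on the abacus -/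

section Ribbons

/-- The position of the bead of row `a` on the abacus of a Young diagram. Rows are numbered from `0`
and empty rows are included, so bead positions can be negative. -/
def bead (nu : YoungDiagram) (a : ℕ) : ℤ := (nu.rowLen a : ℤ) - a

theorem bead_strictAnti (nu : YoungDiagram) : StrictAnti (bead nu) :=
  strictAnti_nat_of_succ_lt fun a => by
    have := nu.rowLen_anti a (a + 1) (Nat.le_succ a)
    simp only [bead]; push_cast; omega

theorem YoungDiagram.le_iff_rowLen_le {nu nu' : YoungDiagram} :
    nu ≤ nu' ↔ ∀ a, nu.rowLen a ≤ nu'.rowLen a := by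
  constructor
  · intro h a
    by_contra hlt
    have : (a, nu'.rowLen a) ∈ nu := YoungDiagram.mem_iff_lt_rowLen.2 (by omega)
    exact lt_irrefl _ (YoungDiagram.mem_iff_lt_rowLen.1 (h this))
  · rintro h ⟨a, c⟩ hc
    rw [YoungDiagram.mem_iff_lt_rowLen] at hc ⊢
    exact hc.trans_le (h a)

theorem YoungDiagram.ext_rowLen {nu nu' : YoungDiagram} (h : ∀ a, nu.rowLen a = nu'.rowLen a) :
    nu = nu' :=
  le_antisymm (YoungDiagram.le_iff_rowLen_le.2 fun a => (h a).le)
    (YoungDiagram.le_iff_rowLen_le.2 fun a => (h a).ge)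

theorem rowLen_colLen_zero (lam : YoungDiagram) : lam.rowLen (lam.colLen 0) = 0 := by
  by_contra hne
  have : (lam.colLen 0, 0) ∈ lam := YoungDiagram.mem_iff_lt_rowLen.2 (by omega)
  exact lt_irrefl _ (YoungDiagram.mem_iff_lt_colLen.1 this)

theorem mem_skew_iff {nu nu' : YoungDiagram} {a c : ℕ} :
    (a, c) ∈ nu'.cells \ nu.cells ↔ nu.rowLen a ≤ c ∧ c < nu'.rowLen a := by
  rw [mem_sdiff, YoungDiagram.mem_cells, YoungDiagram.mem_cells,
    YoungDiagram.mem_iff_lt_rowLen, YoungDiagram.mem_iff_lt_rowLen]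
  omega

theorem exists_rowLen_eq (f : ℕ → ℕ) (hf : Antitone f) (N : ℕ) (hN : f N = 0) :
    ∃ nu : YoungDiagram, ∀ a, nu.rowLen a = f a := by
  let nu : YoungDiagram :=
    { cells := (range N ×ˢ range (f 0)).filter fun c => c.2 < f c.1
      isLowerSet := by
        rintro ⟨a, c⟩ ⟨a', c'⟩ ⟨h1, h2⟩ h
        simp only [coe_filter, mem_product, mem_range, Set.mem_ofPred_eq] at h h1 h2 ⊢
        have := hf h1
        omega }
  have hmem : ∀ a c, (a, c) ∈ nu ↔ c < f a := by
    intro a c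
    rw [← YoungDiagram.mem_cells]
    simp only [nu, mem_filter, mem_product, mem_range]
    refine ⟨fun h => h.2, fun h => ⟨⟨?_, h.trans_le (hf (Nat.zero_le a))⟩, h⟩⟩
    by_contra hlt
    have := hf (not_lt.1 hlt)
    omega
  refine ⟨nu, fun a => ?_⟩
  have h1 := hmem a (nu.rowLen a)
  have h2 := hmem a (f a)
  rw [YoungDiagram.mem_iff_lt_rowLen] at h1 h2
  omega

/-- `nu'` arises from `nu` by moving the bead of row `i` by `r` positions, after which it is the
bead of row `j` and the beads that it passed go down by one row. For `r > 0` this says that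
`nu' / nu` is a border strip of length `r` which meets the rows `j, …, i`. -/
structure IsRibbonMove (nu nu' : YoungDiagram) (r j i : ℕ) : Prop where
  le : j ≤ i
  bead_top : bead nu' j = bead nu i + r
  bead_succ : ∀ a, j ≤ a → a < i → bead nu' (a + 1) = bead nu a
  rowLen_eq : ∀ a, a < j ∨ i < a → nu'.rowLen a = nu.rowLen a

theorem card_skew_of_shift {nu nu' : YoungDiagram} (hle : nu ≤ nu') {j i : ℕ} (hji : j ≤ i)
    (hsucc : ∀ a, j ≤ a → a < i → bead nu' (a + 1) = bead nu a)
    (heq : ∀ a, a < j ∨ i < a → nu'.rowLen a = nu.rowLen a) :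
    (#(nu'.cells \ nu.cells) : ℤ) = bead nu' j - bead nu i := by
  have hrow := YoungDiagram.le_iff_rowLen_le.1 hle
  have h1 : (#(nu'.cells \ nu.cells) : ℤ) =
      ∑ a ∈ range (i + 1), (bead nu' a - bead nu a) := by
    rw [card_eq_sum_card_fiberwise (f := Prod.fst) (t := range (i + 1))]
    · push_cast
      refine sum_congr rfl fun a _ => ?_
      have : ({x ∈ nu'.cells \ nu.cells | x.1 = a}) =
          (Ico (nu.rowLen a) (nu'.rowLen a)).map (Function.Embedding.sectR a ℕ) := by
        ext ⟨b, c⟩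
        simp only [mem_filter, mem_skew_iff, mem_map, mem_Ico, Function.Embedding.sectR_apply,
          Prod.mk.injEq]
        constructor
        · rintro ⟨h, rfl⟩
          exact ⟨c, h, rfl, rfl⟩
        · rintro ⟨d, h, rfl, rfl⟩
          exact ⟨h, rfl⟩
      rw [this, card_map, Nat.card_Ico]
      have := hrow a
      simp only [bead]
      omega
    · rintro ⟨a, c⟩ hc
      have h := mem_skew_iff.1 hc
      simp only [coe_range, Set.mem_Iio]
      by_contra hlt
      have := heq a (Or.inr (by omega))
      omega
  rw [h1]
  clear h1 hrow
  have heq' : ∀ a, a < j → bead nu' a = bead nu a := fun a ha => by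
    simp only [bead, heq a (Or.inl ha)]
  clear heq
  induction i, hji using Nat.le_induction with
  | base =>
    rw [sum_range_succ, sum_eq_zero, zero_add]
    intro a ha
    rw [heq' a (mem_range.1 ha), sub_self]
  | succ i hi ih =>
    rw [sum_range_succ, ih fun a h1 h2 => hsucc a h1 (by omega), hsucc i hi (by omega)]
    ring

/-- A border strip passes from row `a` to row `a + 1` in some column. -/
theorem IsBorderStrip.exists_common_column {S : Finset (ℕ × ℕ)} (hS : IsBorderStrip S)
    {x y : ℕ × ℕ} (hx : x ∈ S) (hy : y ∈ S) {a : ℕ} (hxa : x.1 ≤ a) (hya : a < y.1) :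
    ∃ c, (a, c) ∈ S ∧ (a + 1, c) ∈ S := by
  by_contra hno
  push Not at hno
  have : ∀ z, Relation.ReflTransGen (fun x y => y ∈ S ∧ BoxAdj x y) x z → z ∈ S ∧ z.1 ≤ a := by
    intro z hz
    induction hz with
    | refl => exact ⟨hx, hxa⟩
    | @tail u v _ huv ih =>
      refine ⟨huv.1, ?_⟩
      by_contra hlt
      obtain ⟨u1, u2⟩ := u
      obtain ⟨v1, v2⟩ := v
      have hadj := huv.2
      simp only [BoxAdj] at hadj ih hlt
      obtain ⟨rfl, rfl, rfl⟩ : u1 = a ∧ v1 = a + 1 ∧ v2 = u2 := by omega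
      exact hno _ ih.1 huv.1
  have := (this y (hS.2.1 x hx y hy)).2
  omega

theorem IsBorderStrip.exists_isRibbonMove {nu nu' : YoungDiagram} (hle : nu ≤ nu') {r : ℕ}
    (hS : IsBorderStrip (nu'.cells \ nu.cells)) (hr : #(nu'.cells \ nu.cells) = r) :
    ∃ j i, IsRibbonMove nu nu' r j i := by
  have hrow := YoungDiagram.le_iff_rowLen_le.1 hle
  obtain ⟨x, hx, hxmin⟩ := exists_min_image _ Prod.fst hS.1
  obtain ⟨y, hy, hymax⟩ := exists_max_image _ Prod.fst hS.1
  have hsucc : ∀ a, x.1 ≤ a → a < y.1 → bead nu' (a + 1) = bead nu a := by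
    intro a h1 h2
    obtain ⟨c, hc1, hc2⟩ := hS.exists_common_column hx hy h1 h2
    rw [mem_skew_iff] at hc1 hc2
    have h3 := hS.2.2 a (nu.rowLen a)
    simp only [mem_skew_iff] at h3
    have h4 := nu'.rowLen_anti a (a + 1) (Nat.le_succ a)
    have h5 := nu.rowLen_anti a (a + 1) (Nat.le_succ a)
    simp only [bead]
    push_cast
    omega
  have heq : ∀ a, a < x.1 ∨ y.1 < a → nu'.rowLen a = nu.rowLen a := by
    intro a ha
    by_contra hne
    have hmem : (a, nu.rowLen a) ∈ nu'.cells \ nu.cells :=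
      mem_skew_iff.2 ⟨le_rfl, lt_of_le_of_ne (hrow a) (Ne.symm hne)⟩
    have h1 := hxmin _ hmem
    have h2 := hymax _ hmem
    simp only at h1 h2
    omega
  have hxy : x.1 ≤ y.1 := hxmin y hy
  refine ⟨x.1, y.1, hxy, ?_, hsucc, heq⟩
  have := card_skew_of_shift hle hxy hsucc heq
  rw [← hr]
  omega

namespace IsRibbonMove

variable {nu nu' : YoungDiagram} {r j i : ℕ}

theorem rowLen_succ (h : IsRibbonMove nu nu' r j i) {a : ℕ} (h1 : j ≤ a) (h2 : a < i) :
    nu'.rowLen (a + 1) = nu.rowLen a + 1 := by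
  have := h.bead_succ a h1 h2
  simp only [bead] at this
  push_cast at this
  omega

theorem rowLen_lt (h : IsRibbonMove nu nu' r j i) (hr : 0 < r) {a : ℕ} (h1 : j ≤ a) (h2 : a ≤ i) :
    nu.rowLen a < nu'.rowLen a := by
  rcases eq_or_lt_of_le h2 with rfl | h2
  · rcases eq_or_lt_of_le h1 with rfl | h1
    · have := h.bead_top
      simp only [bead] at this
      omega
    · obtain ⟨b, rfl⟩ := Nat.exists_eq_succ_of_ne_zero (by omega : a ≠ 0)
      have h3 := h.rowLen_succ (a := b) (by omega) (by omega)
      have := nu.rowLen_anti b (b + 1) (Nat.le_succ b)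
      simp only [Nat.succ_eq_add_one]
      omega
  · have h3 := h.rowLen_succ h1 h2
    have := nu'.rowLen_anti a (a + 1) (Nat.le_succ a)
    omega

theorem diagram_le (h : IsRibbonMove nu nu' r j i) (hr : 0 < r) : nu ≤ nu' := by
  rw [YoungDiagram.le_iff_rowLen_le]
  intro a
  by_cases ha : a < j ∨ i < a
  · exact (h.rowLen_eq a ha).ge
  · exact (h.rowLen_lt hr (by omega) (by omega)).le

theorem row_mem (h : IsRibbonMove nu nu' r j i) {a c : ℕ}
    (hc : (a, c) ∈ nu'.cells \ nu.cells) : j ≤ a ∧ a ≤ i := by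
  rw [mem_skew_iff] at hc
  by_contra hlt
  have := h.rowLen_eq a (by omega)
  omega

theorem left_end_mem (h : IsRibbonMove nu nu' r j i) (hr : 0 < r) {a : ℕ} (h1 : j ≤ a)
    (h2 : a ≤ i) : (a, nu.rowLen a) ∈ nu'.cells \ nu.cells :=
  mem_skew_iff.2 ⟨le_rfl, h.rowLen_lt hr h1 h2⟩

theorem card_eq (h : IsRibbonMove nu nu' r j i) (hr : 0 < r) :
    #(nu'.cells \ nu.cells) = r := by
  have := card_skew_of_shift (h.diagram_le hr) h.le h.bead_succ h.rowLen_eq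
  have := h.bead_top
  omega

theorem stripRow_eq (h : IsRibbonMove nu nu' r j i) (hr : 0 < r) :
    stripRow (nu'.cells \ nu.cells) = j := by
  rw [stripRow]
  refine le_antisymm (Nat.sInf_le ⟨_, h.left_end_mem hr le_rfl h.le⟩) ?_
  refine le_csInf ⟨_, _, h.left_end_mem hr le_rfl h.le⟩ ?_
  rintro a ⟨c, hc⟩
  exact (h.row_mem hc).1

theorem stripHeight_eq (h : IsRibbonMove nu nu' r j i) (hr : 0 < r) :
    stripHeight (nu'.cells \ nu.cells) = i - j := by
  have : (nu'.cells \ nu.cells).image Prod.fst = Icc j i := by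
    ext a
    rw [mem_image, mem_Icc]
    constructor
    · rintro ⟨⟨b, c⟩, hc, rfl⟩
      exact h.row_mem hc
    · rintro ⟨h1, h2⟩
      exact ⟨_, h.left_end_mem hr h1 h2, rfl⟩
  rw [stripHeight, this, Nat.card_Icc]
  have := h.le
  omega

theorem isBorderStrip (h : IsRibbonMove nu nu' r j i) (hr : 0 < r) :
    IsBorderStrip (nu'.cells \ nu.cells) := by
  refine ⟨⟨_, h.left_end_mem hr le_rfl h.le⟩, ?_, ?_⟩
  · set S := nu'.cells \ nu.cells with hSdef
    let R : ℕ × ℕ → ℕ × ℕ → Prop := fun x y => (x ∈ S ∧ y ∈ S) ∧ BoxAdj x y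
    have hsymm : ∀ x y, R x y → R y x := by
      rintro ⟨x1, x2⟩ ⟨y1, y2⟩ ⟨h1, h2⟩
      refine ⟨h1.symm, ?_⟩
      simp only [BoxAdj] at h2 ⊢
      omega
    -- every box is connected to the bottom left end of the strip
    have hpath : ∀ k a c, (a, c) ∈ S → c + (i - a) = k →
        Relation.ReflTransGen R (a, c) (i, nu.rowLen i) := by
      intro k
      induction k using Nat.strong_induction_on with
      | _ k ih =>
        intro a c hac hk
        have hrow := h.row_mem hac
        have hac' := mem_skew_iff.1 hac
        rcases lt_or_eq_of_le hac'.1 with hlt | heq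
        · obtain ⟨d, rfl⟩ := Nat.exists_eq_succ_of_ne_zero (by omega : c ≠ 0)
          have hmem : (a, d) ∈ S := mem_skew_iff.2 (by omega)
          refine .head ⟨⟨hac, hmem⟩, Or.inl ⟨rfl, Or.inr rfl⟩⟩ (ih _ (by omega) a d hmem rfl)
        · rcases lt_or_eq_of_le hrow.2 with hai | rfl
          · have h1 := h.rowLen_succ hrow.1 hai
            have h2 := nu.rowLen_anti a (a + 1) (Nat.le_succ a)
            have hmem : (a + 1, c) ∈ S := mem_skew_iff.2 (by omega)
            refine .head ⟨⟨hac, hmem⟩, Or.inr ⟨rfl, Or.inl rfl⟩⟩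
              (ih (c + (i - (a + 1))) (by omega) (a + 1) c hmem rfl)
          · rw [heq]
    rintro ⟨a, c⟩ hx ⟨b, d⟩ hy
    have h1 := hpath _ a c hx rfl
    have h2 := hpath _ b d hy rfl
    have : Std.Symm R := ⟨hsymm⟩
    have h3 : Relation.ReflTransGen R (i, nu.rowLen i) (b, d) := symm h2
    exact Relation.ReflTransGen.mono (fun x y hxy => ⟨hxy.1.2, hxy.2⟩) _ _ (h1.trans h3)
  · rintro a c ⟨h1, -, -, h2⟩
    have h3 := h.row_mem h1
    have h4 := h.row_mem h2
    have h5 := h.rowLen_succ h3.1 (by omega)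
    rw [mem_skew_iff] at h1 h2
    omega

theorem unique {nu'' : YoungDiagram} {j' : ℕ} (h : IsRibbonMove nu nu' r j i)
    (h' : IsRibbonMove nu nu'' r j' i) : j = j' ∧ nu' = nu'' := by
  have key : ∀ {nu' nu'' : YoungDiagram} {j j' : ℕ}, IsRibbonMove nu nu' r j i →
      IsRibbonMove nu nu'' r j' i → j ≤ j' := by
    intro nu' nu'' j j' h h'
    by_contra hlt
    have h1 : bead nu' j' = bead nu j' := by simp only [bead, h.rowLen_eq j' (by omega)]
    have h2 := bead_strictAnti nu' (by omega : j' < j)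
    have h3 := h.bead_top
    have h4 := h'.bead_top
    have h5 := h.le
    have h6 := h'.bead_succ j' le_rfl (by omega)
    have h7 := bead_strictAnti nu'' (Nat.lt_succ_self j')
    simp only [Nat.succ_eq_add_one] at h7
    omega
  have hj := le_antisymm (key h h') (key h' h)
  subst hj
  refine ⟨rfl, YoungDiagram.ext_rowLen fun a => ?_⟩
  by_cases ha : a < j ∨ i < a
  · rw [h.rowLen_eq a ha, h'.rowLen_eq a ha]
  · rcases Nat.eq_or_lt_of_le (by omega : j ≤ a) with rfl | hlt
    · have h1 := h.bead_top
      have h2 := h'.bead_top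
      simp only [bead] at h1 h2
      omega
    · obtain ⟨b, rfl⟩ := Nat.exists_eq_succ_of_ne_zero (by omega : a ≠ 0)
      rw [Nat.succ_eq_add_one, h.rowLen_succ (by omega) (by omega),
        h'.rowLen_succ (by omega) (by omega)]

theorem unique_index {j' i' : ℕ} (h : IsRibbonMove nu nu' r j i)
    (h' : IsRibbonMove nu nu' r j' i') (hr : 0 < r) : i = i' := by
  have key : ∀ {j j' i i' : ℕ}, IsRibbonMove nu nu' r j i →
      IsRibbonMove nu nu' r j' i' → i ≤ i' := by
    intro j j' i i' h h'
    by_contra hlt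
    have h1 := h.rowLen_lt hr h.le le_rfl
    have h2 := h'.rowLen_eq i (by omega)
    omega
  exact le_antisymm (key h h') (key h' h)

end IsRibbonMove

/-- A bead can be moved to any position that is not occupied. -/
theorem exists_isRibbonMove (nu : YoungDiagram) {r : ℕ} (hr : 0 < r) (i : ℕ)
    (hi : ∀ a ≤ i, bead nu a ≠ bead nu i + r) :
    ∃ nu' j, IsRibbonMove nu nu' r j i := by
  classical
  have hex : ∃ a, bead nu a < bead nu i + r := ⟨i, by omega⟩
  obtain ⟨j, hj, hmin⟩ : ∃ j, bead nu j < bead nu i + r ∧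
      ∀ a < j, ¬ bead nu a < bead nu i + r :=
    ⟨Nat.find hex, Nat.find_spec hex, fun a => Nat.find_min hex⟩
  have hji : j ≤ i := by
    by_contra hlt
    have := hmin i (by omega)
    omega
  have hgt : ∀ a < j, bead nu i + r < bead nu a := fun a ha => by
    have h1 := hmin a ha
    have h2 := hi a (by omega)
    omega
  -- the row lengths of the new diagram
  let f : ℕ → ℕ := fun a =>
    if a < j then nu.rowLen a
    else if a = j then (bead nu i + r + j).toNat
    else if a ≤ i then nu.rowLen (a - 1) + 1
    else nu.rowLen a
  have hf : Antitone f := by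
    refine antitone_nat_of_succ_le fun a => ?_
    have h0 := nu.rowLen_anti a (a + 1) (Nat.le_succ a)
    have h1 := nu.rowLen_anti (a - 1) a (Nat.sub_le a 1)
    have h2 := hgt a
    have h3 : j = a → (nu.rowLen a : ℤ) - a < bead nu i + r := by rintro rfl; exact hj
    simp only [bead] at h2 h3
    simp only [f, bead, Nat.add_sub_cancel]
    split_ifs <;> omega
  have hzero := rowLen_colLen_zero nu
  obtain ⟨nu', hnu'⟩ := exists_rowLen_eq f hf (nu.colLen 0 + i + 1) (by
    have := nu.rowLen_anti (nu.colLen 0) (nu.colLen 0 + i + 1) (by omega)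
    simp only [f]
    split_ifs <;> omega)
  refine ⟨nu', j, hji, ?_, fun a h1 h2 => ?_, fun a ha => ?_⟩
  · have h1 : nu'.rowLen j = (bead nu i + r + j).toNat := by simp [hnu', f]
    simp only [bead] at h1 hj ⊢
    omega
  · have h3 : nu'.rowLen (a + 1) = nu.rowLen a + 1 := by
      simp only [hnu', f, Nat.add_sub_cancel]
      split_ifs <;> omega
    simp only [bead]
    push_cast
    omega
  · simp only [hnu', f]
    split_ifs <;> omega

/-- Sorting the beads after a move is a cycle, of sign `(-1) ^ (i - j)`. -/
theorem IsRibbonMove.update_bead {l : ℕ} {nu nu' : YoungDiagram} {r : ℕ} {j i : Fin l}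
    (h : IsRibbonMove nu nu' r j i) :
    Function.update (fun a : Fin l => bead nu a) i (bead nu i + r) =
      (fun a : Fin l => bead nu' a) ∘ Fin.cycleIcc j i := by
  have : NeZero l := ⟨by have := i.2; omega⟩
  have hji : j ≤ i := h.le
  funext k
  rw [Function.comp_apply]
  by_cases hki : k = i
  · subst hki
    rw [Function.update_self, Fin.cycleIcc_of_last hji, h.bead_top]
  · rw [Function.update_of_ne hki]
    rcases lt_or_ge k j with hkj | hkj
    · rw [Fin.cycleIcc_of_lt hkj, bead, bead, h.rowLen_eq k (Or.inl hkj)]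
    · rcases lt_or_gt_of_ne hki with hlt | hgt
      · have h1 : ((k + 1 : Fin l) : ℕ) = k + 1 := by
          have : (k : ℕ) + 1 < l := by have := i.2; have : (k : ℕ) < i := hlt; omega
          rw [Fin.val_add, Fin.val_one', Nat.add_mod_mod, Nat.mod_eq_of_lt this]
        rw [Fin.cycleIcc_of_ge_of_lt hkj hlt, h1, h.bead_succ k hkj hlt]
      · rw [Fin.cycleIcc_of_gt hgt, bead, bead, h.rowLen_eq k (Or.inr hgt)]

end Ribbons

/-! ### Border-strip tableaux built strip by strip -/

section Tableaux

variable {lam nu nu' : YoungDiagram}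

theorem mem_labelBoxes {k : ℕ} {T : SkewBox lam nu → Fin k} {p : Fin k} {x : ℕ × ℕ} :
    x ∈ labelBoxes T p ↔ ∃ h : x ∈ lam.cells \ nu.cells, T ⟨x, h⟩ = p := by
  simp [labelBoxes]

/-- The labelling of `lam / nu` with label `0` on `nu' / nu` and the labels of `T`, raised by one, on
`lam / nu'`. -/
def prependStrip (nu nu' : YoungDiagram) {k : ℕ} (T : SkewBox lam nu' → Fin k) :
    SkewBox lam nu → Fin (k + 1) := fun c =>
  if h : c.1 ∈ nu'.cells then 0
  else (T ⟨c.1, mem_sdiff.2 ⟨(mem_sdiff.1 c.2).1, h⟩⟩).succ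

theorem prependStrip_of_mem {k : ℕ} (T : SkewBox lam nu' → Fin k) {c : SkewBox lam nu}
    (h : c.1 ∈ nu'.cells) : prependStrip nu nu' T c = 0 := dif_pos h

theorem prependStrip_of_notMem {k : ℕ} (T : SkewBox lam nu' → Fin k) {c : SkewBox lam nu}
    (h : c.1 ∉ nu'.cells) : prependStrip nu nu' T c =
      (T ⟨c.1, mem_sdiff.2 ⟨(mem_sdiff.1 c.2).1, h⟩⟩).succ := dif_neg h

theorem labelBoxes_prependStrip_zero (h' : nu' ≤ lam) {k : ℕ} (T : SkewBox lam nu' → Fin k) :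
    labelBoxes (prependStrip nu nu' T) 0 = nu'.cells \ nu.cells := by
  ext x
  rw [mem_labelBoxes]
  constructor
  · rintro ⟨hx, hT⟩
    refine mem_sdiff.2 ⟨?_, (mem_sdiff.1 hx).2⟩
    by_contra hne
    rw [prependStrip_of_notMem T hne] at hT
    exact Fin.succ_ne_zero _ hT
  · intro hx
    rw [mem_sdiff] at hx
    exact ⟨mem_sdiff.2 ⟨YoungDiagram.cells_subset_iff.2 h' hx.1, hx.2⟩,
      prependStrip_of_mem T hx.1⟩

theorem labelBoxes_prependStrip_succ (h : nu ≤ nu') {k : ℕ} (T : SkewBox lam nu' → Fin k)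
    (p : Fin k) : labelBoxes (prependStrip nu nu' T) p.succ = labelBoxes T p := by
  ext x
  rw [mem_labelBoxes, mem_labelBoxes]
  constructor
  · rintro ⟨hx, hT⟩
    by_cases hne : x ∈ nu'.cells
    · rw [prependStrip_of_mem T hne] at hT
      exact absurd hT.symm (Fin.succ_ne_zero _)
    · rw [prependStrip_of_notMem T hne] at hT
      exact ⟨_, Fin.succ_injective _ hT⟩
  · rintro ⟨hx, rfl⟩
    have hx' := mem_sdiff.1 hx
    exact ⟨mem_sdiff.2 ⟨hx'.1, fun hn => hx'.2 (YoungDiagram.cells_subset_iff.2 h hn)⟩,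
      prependStrip_of_notMem T hx'.2⟩

theorem isBorderStripTableau_prependStrip (h : nu ≤ nu') (h' : nu' ≤ lam) {r : ℕ} {α : List ℕ}
    (T : SkewBox lam nu' → Fin α.length) :
    IsBorderStripTableau (r :: α) (prependStrip nu nu' T) ↔
      (IsBorderStrip (nu'.cells \ nu.cells) ∧ #(nu'.cells \ nu.cells) = r) ∧
        IsBorderStripTableau α T := by
  have hmem : ∀ c : SkewBox lam nu', c.1 ∈ lam.cells \ nu.cells := fun c => by
    have := mem_sdiff.1 c.2
    exact mem_sdiff.2 ⟨this.1, fun hn => this.2 (YoungDiagram.cells_subset_iff.2 h hn)⟩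
  have hres : ∀ c d : SkewBox lam nu',
      prependStrip nu nu' T ⟨c.1, hmem c⟩ ≤ prependStrip nu nu' T ⟨d.1, hmem d⟩ → T c ≤ T d := by
    intro c d hcd
    rw [prependStrip_of_notMem T (c := ⟨c.1, hmem c⟩) (mem_sdiff.1 c.2).2,
      prependStrip_of_notMem T (c := ⟨d.1, hmem d⟩) (mem_sdiff.1 d.2).2] at hcd
    exact Fin.succ_le_succ_iff.1 hcd
  have hext : ∀ c d : SkewBox lam nu, c.1.1 ≤ d.1.1 → c.1.2 ≤ d.1.2 →
      (∀ hc hd, T ⟨c.1, hc⟩ ≤ T ⟨d.1, hd⟩) →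
      prependStrip nu nu' T c ≤ prependStrip nu nu' T d := by
    intro c d h1 h2 hT
    by_cases hc : c.1 ∈ nu'.cells
    · rw [prependStrip_of_mem T hc]
      exact Fin.zero_le _
    · have hd : d.1 ∉ nu'.cells := fun hd => hc (nu'.up_left_mem h1 h2 hd)
      rw [prependStrip_of_notMem T hc, prependStrip_of_notMem T hd]
      exact Fin.succ_le_succ_iff.2 (hT _ _)
  constructor
  · intro H
    refine ⟨⟨?_, ?_⟩, ⟨fun c d h1 h2 => hres c d (H.row_weak _ _ h1 h2),
      fun c d h1 h2 => hres c d (H.col_weak _ _ h1 h2), fun p => ?_, fun p => ?_⟩⟩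
    · rw [← labelBoxes_prependStrip_zero h' T]
      exact H.strip 0
    · rw [← labelBoxes_prependStrip_zero h' T]
      exact H.length_eq 0
    · rw [← labelBoxes_prependStrip_succ h T]
      exact H.strip p.succ
    · rw [← labelBoxes_prependStrip_succ h T]
      exact H.length_eq p.succ
  · rintro ⟨⟨H1, H2⟩, H⟩
    refine ⟨fun c d h1 h2 => hext c d h1.le h2 fun _ _ => H.row_weak _ _ h1 h2,
      fun c d h1 h2 => hext c d h2 h1.le fun _ _ => H.col_weak _ _ h1 h2, fun p => ?_, fun p => ?_⟩
    · refine Fin.cases ?_ (fun p => ?_) p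
      · exact (labelBoxes_prependStrip_zero h' T).symm ▸ H1
      · exact (labelBoxes_prependStrip_succ h T p).symm ▸ H.strip p
    · refine Fin.cases ?_ (fun p => ?_) p
      · exact (labelBoxes_prependStrip_zero h' T).symm ▸ H2
      · exact (labelBoxes_prependStrip_succ h T p).symm ▸ H.length_eq p

theorem tableauSign_prependStrip (h : nu ≤ nu') (h' : nu' ≤ lam) {k : ℕ}
    (T : SkewBox lam nu' → Fin k) : tableauSign (prependStrip nu nu' T) =
      (-1) ^ stripHeight (nu'.cells \ nu.cells) * tableauSign T := by
  simp only [tableauSign, Fin.sum_univ_succ, labelBoxes_prependStrip_zero h',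
    labelBoxes_prependStrip_succ h, pow_add]

/-- A border-strip tableau is monotone, not only along rows and columns: a skew diagram contains
the corner in the row of `c` and the column of `d`. -/
theorem IsBorderStripTableau.mono {α : List ℕ} {T : SkewBox lam nu → Fin α.length}
    (hT : IsBorderStripTableau α T) {c d : SkewBox lam nu} (h1 : c.1.1 ≤ d.1.1)
    (h2 : c.1.2 ≤ d.1.2) : T c ≤ T d := by
  have hc := mem_sdiff.1 c.2
  have hd := mem_sdiff.1 d.2
  have he : (c.1.1, d.1.2) ∈ lam.cells \ nu.cells :=
    mem_sdiff.2 ⟨lam.up_left_mem h1 le_rfl hd.1, fun hn => hc.2 (nu.up_left_mem le_rfl h2 hn)⟩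
  exact (hT.row_weak c ⟨_, he⟩ rfl h2).trans (hT.col_weak ⟨_, he⟩ d rfl h1)

theorem IsBorderStripTableau.exists_prependStrip (hnu : nu ≤ lam) {r : ℕ} {α : List ℕ}
    {T : SkewBox lam nu → Fin (α.length + 1)} (hT : IsBorderStripTableau (r :: α) T) :
    ∃ nu', nu ≤ nu' ∧ nu' ≤ lam ∧ ∃ T' : SkewBox lam nu' → Fin α.length,
      prependStrip nu nu' T' = T := by
  classical
  have hsub := YoungDiagram.cells_subset_iff.2 hnu
  have hlab : labelBoxes T 0 ⊆ lam.cells := fun x hx => (mem_sdiff.1 (mem_labelBoxes.1 hx).1).1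
  let nu' : YoungDiagram :=
    { cells := nu.cells ∪ labelBoxes T 0
      isLowerSet := by
        rintro ⟨a, c⟩ ⟨a', c'⟩ ⟨h1, h2⟩ h
        simp only [coe_union, Set.mem_union, mem_coe] at h ⊢
        rcases h with h | h
        · exact Or.inl (nu.up_left_mem h1 h2 h)
        · by_cases hn : (a', c') ∈ nu.cells
          · exact Or.inl hn
          · right
            obtain ⟨hx, h0⟩ := mem_labelBoxes.1 h
            have hy : (a', c') ∈ lam.cells \ nu.cells :=
              mem_sdiff.2 ⟨lam.up_left_mem h1 h2 (mem_sdiff.1 hx).1, hn⟩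
            refine mem_labelBoxes.2 ⟨hy, le_antisymm ?_ (Fin.zero_le _)⟩
            rw [← h0]
            exact hT.mono h1 h2 }
  have hne : ∀ c : SkewBox lam nu', ∃ h : c.1 ∈ lam.cells \ nu.cells, T ⟨c.1, h⟩ ≠ 0 := by
    intro c
    have hc := mem_sdiff.1 c.2
    have hc2 : c.1 ∉ nu.cells ∪ labelBoxes T 0 := hc.2
    rw [mem_union, not_or] at hc2
    have h : c.1 ∈ lam.cells \ nu.cells := mem_sdiff.2 ⟨hc.1, hc2.1⟩
    exact ⟨h, fun h0 => hc2.2 (mem_labelBoxes.2 ⟨h, h0⟩)⟩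
  refine ⟨nu', YoungDiagram.cells_subset_iff.1 subset_union_left,
    YoungDiagram.cells_subset_iff.1 (union_subset hsub hlab),
    fun c => (T ⟨c.1, (hne c).1⟩).pred (hne c).2, ?_⟩
  funext c
  by_cases hc : c.1 ∈ nu'.cells
  · rw [prependStrip_of_mem _ hc]
    rcases mem_union.1 hc with h | h
    · exact absurd h (mem_sdiff.1 c.2).2
    · exact (mem_labelBoxes.1 h).2.symm
  · rw [prependStrip_of_notMem _ hc, Fin.succ_pred]

theorem finite_setOf_le (lam : YoungDiagram) : {nu : YoungDiagram | nu ≤ lam}.Finite := by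
  refine Set.Finite.of_finite_image (f := YoungDiagram.cells) ?_ ?_
  · refine (finite_toSet lam.cells.powerset).subset ?_
    rintro _ ⟨nu, h, rfl⟩
    exact mem_coe.2 (mem_powerset.2 (YoungDiagram.cells_subset_iff.2 h))
  · intro nu _ nu' _ h
    exact YoungDiagram.ext h

open Classical in
/-- The sum of the signs of the border-strip tableaux of shape `lam / nu` and type `α` whose list of
row numbers satisfies `C`. It is `0` if `nu` is not contained in `lam`. -/
noncomputable def tableauSum (lam nu : YoungDiagram) (α : List ℕ) (C : List ℕ → Prop) : ℤ :=
  if nu ≤ lam then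
    ∑ T : SkewBox lam nu → Fin α.length with IsBorderStripTableau α T ∧
      C (List.ofFn fun p => stripRow (labelBoxes T p)), tableauSign T
  else 0

theorem tableauSum_of_not (α : List ℕ) {C : List ℕ → Prop} (h : ∀ L, ¬ C L) :
    tableauSum lam nu α C = 0 := by
  classical
  rw [tableauSum]
  split_ifs
  · rw [filter_false_of_mem (fun T _ hT => h _ hT.2), sum_empty]
  · rfl

theorem tableauSum_nil {C : List ℕ → Prop} (hC : C []) [Decidable (nu = lam)] :
    tableauSum lam nu [] C = if nu = lam then 1 else 0 := by
  classical
  rw [tableauSum]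
  by_cases hle : nu ≤ lam
  · rw [if_pos hle]
    by_cases heq : nu = lam
    · subst heq
      have : IsEmpty (SkewBox nu nu) := ⟨fun c => by simpa using c.2⟩
      rw [if_pos rfl, filter_true_of_mem, Fintype.sum_unique]
      · simp [tableauSign]
      · intro T _
        refine ⟨⟨fun c => isEmptyElim c, fun c => isEmptyElim c, fun p => p.elim0,
          fun p => p.elim0⟩, ?_⟩
        simpa using hC
    · rw [if_neg heq]
      refine sum_eq_zero fun T _ => ?_
      have hne : (lam.cells \ nu.cells).Nonempty := by
        rw [nonempty_iff_ne_empty, Ne, sdiff_eq_empty_iff_subset]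
        exact fun hsub => heq (le_antisymm hle (YoungDiagram.cells_subset_iff.1 hsub))
      exact (T ⟨_, hne.choose_spec⟩).elim0
  · rw [if_neg hle, if_neg]
    rintro rfl
    exact hle le_rfl

open Classical in
/-- Removing the strip with the first label. -/
theorem tableauSum_cons_eq_sum (hnu : nu ≤ lam) (r : ℕ) (α : List ℕ) (C : List ℕ → Prop) :
    tableauSum lam nu (r :: α) C =
      ∑ nu' ∈ (finite_setOf_le lam).toFinset with nu ≤ nu' ∧
          IsBorderStrip (nu'.cells \ nu.cells) ∧ #(nu'.cells \ nu.cells) = r,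
        (-1) ^ stripHeight (nu'.cells \ nu.cells) *
          tableauSum lam nu' α fun L => C (stripRow (nu'.cells \ nu.cells) :: L) := by
  have hinner : ∀ nu' ∈ ({nu' ∈ (finite_setOf_le lam).toFinset | nu ≤ nu' ∧
          IsBorderStrip (nu'.cells \ nu.cells) ∧ #(nu'.cells \ nu.cells) = r}),
      (-1) ^ stripHeight (nu'.cells \ nu.cells) *
          (tableauSum lam nu' α fun L => C (stripRow (nu'.cells \ nu.cells) :: L)) =
      ∑ T : SkewBox lam nu' → Fin α.length with IsBorderStripTableau α T ∧
        C (stripRow (nu'.cells \ nu.cells) :: List.ofFn fun p => stripRow (labelBoxes T p)),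
        tableauSign (prependStrip nu nu' T) := by
    intro nu' h
    simp only [mem_filter, Set.Finite.mem_toFinset, Set.mem_ofPred_eq] at h
    rw [tableauSum, if_pos h.1, Finset.mul_sum]
    exact sum_congr rfl fun T _ => (tableauSign_prependStrip h.2.1 h.1 T).symm
  rw [sum_congr rfl hinner, Finset.sum_sigma', tableauSum, if_pos hnu]
  symm
  have hC : ∀ {nu'} (h : nu ≤ nu') (h' : nu' ≤ lam) (T : SkewBox lam nu' → Fin α.length),
      (List.ofFn fun p => stripRow (labelBoxes (prependStrip nu nu' T) p)) =
      stripRow (nu'.cells \ nu.cells) :: List.ofFn fun p => stripRow (labelBoxes T p) := by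
    intro nu' h h' T
    rw [List.ofFn_succ, labelBoxes_prependStrip_zero h']
    simp only [labelBoxes_prependStrip_succ h]
  refine sum_bij (fun p _ => prependStrip nu p.1 p.2) ?_ ?_ ?_ (fun _ _ => rfl)
  · rintro ⟨nu', T⟩ h
    simp only [mem_sigma, mem_filter, Set.Finite.mem_toFinset, Set.mem_ofPred_eq, mem_univ,
      true_and] at h ⊢
    refine ⟨(isBorderStripTableau_prependStrip h.1.2.1 h.1.1 T).2 ⟨h.1.2.2, h.2.1⟩, ?_⟩
    have := hC h.1.2.1 h.1.1 T
    exact this.symm ▸ h.2.2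
  · rintro ⟨nu', T⟩ h ⟨nu'', T'⟩ h' heq
    simp only [mem_sigma, mem_filter, Set.Finite.mem_toFinset, Set.mem_ofPred_eq, mem_univ,
      true_and] at h h' heq
    have hnn : nu' = nu'' := by
      have h1 := labelBoxes_prependStrip_zero (nu := nu) h.1.1 T
      rw [heq, labelBoxes_prependStrip_zero (nu := nu) h'.1.1 T'] at h1
      have h2 : nu.cells ⊆ nu'.cells := YoungDiagram.cells_subset_iff.2 h.1.2.1
      have h3 : nu.cells ⊆ nu''.cells := YoungDiagram.cells_subset_iff.2 h'.1.2.1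
      apply YoungDiagram.ext
      rw [← union_sdiff_of_subset h2, ← union_sdiff_of_subset h3, h1]
    subst hnn
    have hT : T = T' := by
      funext c
      have hc := mem_sdiff.1 c.2
      have hc' : c.1 ∈ lam.cells \ nu.cells := mem_sdiff.2
        ⟨hc.1, fun hn => hc.2 (YoungDiagram.cells_subset_iff.2 h.1.2.1 hn)⟩
      have := congrFun heq ⟨c.1, hc'⟩
      rw [prependStrip_of_notMem T (c := ⟨c.1, hc'⟩) hc.2,
        prependStrip_of_notMem T' (c := ⟨c.1, hc'⟩) hc.2] at this
      exact Fin.succ_injective _ this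
    rw [hT]
  · intro T hT
    simp only [mem_filter, mem_univ, true_and] at hT
    obtain ⟨nu', h, h', T', rfl⟩ := hT.1.exists_prependStrip hnu
    have h1 := (isBorderStripTableau_prependStrip h h' T').1 hT.1
    have h2 := hT.2
    refine ⟨⟨nu', T'⟩, ?_, rfl⟩
    simp only [mem_sigma, mem_filter, Set.Finite.mem_toFinset, Set.mem_ofPred_eq, mem_univ,
      true_and]
    refine ⟨⟨h', h, h1.1⟩, h1.2, ?_⟩
    exact hC h h' T' ▸ h2

/-- Removing the strip with the first label, as a sum over the beads of `nu`: `w i` is the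
contribution of the bead of row `i`. -/
theorem tableauSum_cons {r : ℕ} (hr : 0 < r) (α : List ℕ) (C : List ℕ → Prop)
    (w : Fin (lam.colLen 0) → ℤ)
    (hw : ∀ (i : Fin (lam.colLen 0)) nu' (j : ℕ), IsRibbonMove nu nu' r j i →
      w i = (-1) ^ ((i : ℕ) - j) * tableauSum lam nu' α fun L => C (j :: L))
    (hw0 : ∀ i : Fin (lam.colLen 0), (∀ nu' j, ¬ IsRibbonMove nu nu' r j i) → w i = 0) :
    tableauSum lam nu (r :: α) C = ∑ i, w i := by
  classical
  by_cases hnu : nu ≤ lam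
  · rw [tableauSum_cons_eq_sum hnu, ← sum_coe_sort]
    set N := {nu' ∈ (finite_setOf_le lam).toFinset | nu ≤ nu' ∧
          IsBorderStrip (nu'.cells \ nu.cells) ∧ #(nu'.cells \ nu.cells) = r}
    have hN : ∀ nu', nu' ∈ N ↔ nu' ≤ lam ∧ nu ≤ nu' ∧
          IsBorderStrip (nu'.cells \ nu.cells) ∧ #(nu'.cells \ nu.cells) = r := fun nu' => by
      simp [N]
    have hex : ∀ nu' : N, ∃ (i : Fin (lam.colLen 0)) (j : ℕ), IsRibbonMove nu nu' r j i := by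
      rintro ⟨nu', h⟩
      obtain ⟨h1, h2, h3, h4⟩ := (hN _).1 h
      obtain ⟨j, i, hji⟩ := h3.exists_isRibbonMove h2 h4
      have h5 := hji.rowLen_lt hr hji.le le_rfl
      have h6 := YoungDiagram.le_iff_rowLen_le.1 h1 i
      have h7 : (i, 0) ∈ lam := YoungDiagram.mem_iff_lt_rowLen.2 (by omega)
      exact ⟨⟨i, YoungDiagram.mem_iff_lt_colLen.1 h7⟩, j, hji⟩
    choose e j he using hex
    refine sum_of_injOn e ?_ (fun _ _ => mem_coe.2 (mem_univ _)) ?_ ?_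
    · intro nu' _ nu'' _ h
      have h2 := he nu''
      rw [← h] at h2
      exact Subtype.ext ((he nu').unique h2).2
    · intro i _ hi
      by_cases hmove : ∃ nu' j, IsRibbonMove nu nu' r j i
      · obtain ⟨nu', j', h⟩ := hmove
        rw [hw i nu' j' h, tableauSum, if_neg, mul_zero]
        intro hle
        have hmem : nu' ∈ N := (hN _).2 ⟨hle, h.diagram_le hr, h.isBorderStrip hr, h.card_eq hr⟩
        refine hi ⟨⟨nu', hmem⟩, mem_coe.2 (mem_univ _), ?_⟩
        exact Fin.ext ((he ⟨nu', hmem⟩).unique_index h hr)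
      · push Not at hmove
        exact hw0 i hmove
    · intro nu' _
      rw [hw _ _ _ (he nu'), (he nu').stripRow_eq hr, (he nu').stripHeight_eq hr]
  · rw [tableauSum, if_neg hnu]
    symm
    refine sum_eq_zero fun i _ => ?_
    by_cases hmove : ∃ nu' j, IsRibbonMove nu nu' r j i
    · obtain ⟨nu', j', h⟩ := hmove
      rw [hw i nu' j' h, tableauSum, if_neg, mul_zero]
      exact fun hle => hnu ((h.diagram_le hr).trans hle)
    · push Not at hmove
      exact hw0 i hmove

end Tableaux

/-! ### Row numbers, and the comparison of the two recursions -/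

section BlockCondition

/-- The list of row numbers is weakly decreasing within blocks of length `m`, where the first block
has `k` entries and these are bounded by `ρ`. -/
def BlockAntitone (m : ℕ) : ℕ → ℕ∞ → List ℕ → Prop
  | _, _, [] => True
  | 0, _, s :: L => BlockAntitone m (m - 1) s L
  | k + 1, ρ, s :: L => s ≤ ρ ∧ BlockAntitone m k s L

theorem blockAntitone_nil (m k : ℕ) (ρ : ℕ∞) : BlockAntitone m k ρ [] := by
  cases k <;> trivial

theorem blockAntitone_zero_eq_top {m : ℕ} (hm : 0 < m) (ρ : ℕ∞) :
    BlockAntitone m 0 ρ = BlockAntitone m m ⊤ := by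
  obtain ⟨k, rfl⟩ := Nat.exists_eq_succ_of_ne_zero hm.ne'
  funext L
  cases L <;> simp [BlockAntitone]

theorem blockAntitone_iff {m : ℕ} (hm : 0 < m) (L : List ℕ) : ∀ (k : ℕ) (ρ : ℕ∞), k ≤ m →
    (BlockAntitone m k ρ L ↔
      (∀ (p : ℕ) (hp : p < L.length), p < k → (L[p] : ℕ∞) ≤ ρ) ∧
      ∀ (p q : ℕ) (hq : q < L.length) (hpq : p ≤ q),
        (p + (m - k)) / m = (q + (m - k)) / m → L[q] ≤ L[p]) := by
  induction L with
  | nil => intro k ρ _; simp [blockAntitone_nil]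
  | cons s L ih =>
    -- the statement for a list whose first entry begins or continues a block with `k` more entries
    have step : ∀ k < m, (BlockAntitone m k s L ↔
        ∀ (p q : ℕ) (hq : q < (s :: L).length) (hpq : p ≤ q),
        (p + (m - (k + 1))) / m = (q + (m - (k + 1))) / m → (s :: L)[q] ≤ (s :: L)[p]) := by
      intro k hk
      have hdiv : ∀ q, (q + 1 + (m - (k + 1))) / m = 0 ↔ q < k := fun q => by
        rw [Nat.div_eq_zero_iff]; omega
      have hzero : (0 + (m - (k + 1))) / m = 0 := Nat.div_eq_of_lt (by omega)
      have hshift : ∀ q, q + 1 + (m - (k + 1)) = q + (m - k) := fun q => by omega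
      rw [ih k s hk.le]
      constructor
      · rintro ⟨h1, h2⟩ p q hq hpq hpq'
        rcases q with _ | q
        · obtain rfl : p = 0 := by omega
          exact le_rfl
        · simp only [List.length_cons] at hq
          rcases p with _ | p
          · rw [hzero] at hpq'
            have := h1 q (by omega) ((hdiv q).1 hpq'.symm)
            simpa using this
          · rw [hshift, hshift] at hpq'
            simpa using h2 p q (by omega) (by omega) hpq'
      · intro H
        refine ⟨fun p hp hpk => ?_, fun p q hq hpq hpq' => ?_⟩
        · have := H 0 (p + 1) (by simpa using hp) (by omega) (by rw [hzero, (hdiv p).2 hpk])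
          simpa using this
        · have := H (p + 1) (q + 1) (by simpa using hq) (by omega)
            (by rw [hshift, hshift]; exact hpq')
          simpa using this
    intro k ρ hk
    rcases k with _ | k
    · rw [BlockAntitone, step (m - 1) (by omega)]
      have h0 : m - (m - 1 + 1) = 0 := by omega
      simp only [h0, Nat.sub_zero, Nat.add_zero, Nat.add_div_right _ hm, Nat.succ_inj,
        Nat.not_lt_zero, false_imp_iff, implies_true, true_and]
    · rw [BlockAntitone, step k (by omega)]
      refine and_congr_left fun H => ⟨fun hs p hp hpk => ?_, fun h => h 0 (by simp) (by omega)⟩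
      refine le_trans ?_ hs
      have := H 0 p hp (Nat.zero_le _) (by
        rw [Nat.div_eq_of_lt (by omega), Nat.div_eq_of_lt (by omega)])
      exact_mod_cast this

theorem starRepeat_zero (γ : List ℕ) : starRepeat 0 γ = [] := by
  simp [starRepeat]

theorem isMBorderStripTableau_iff {lam mu : YoungDiagram} (m : ℕ) (γ : List ℕ)
    (T : SkewBox lam mu → Fin (starRepeat m γ).length) :
    IsMBorderStripTableau m γ T ↔ IsBorderStripTableau (starRepeat m γ) T ∧
      BlockAntitone m 0 ⊤ (List.ofFn fun p => stripRow (labelBoxes T p)) := by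
  have : BlockAntitone m 0 ⊤ (List.ofFn fun p => stripRow (labelBoxes T p)) ↔
      ∀ p q : Fin (starRepeat m γ).length, p ≤ q → (p : ℕ) / m = (q : ℕ) / m →
        stripRow (labelBoxes T q) ≤ stripRow (labelBoxes T p) := by
    rcases Nat.eq_zero_or_pos m with rfl | hm
    · have hlen : (starRepeat 0 γ).length = 0 := by rw [starRepeat_zero]; rfl
      have hnil : (List.ofFn fun p => stripRow (labelBoxes T p)) = [] := by
        rw [← List.length_eq_zero_iff, List.length_ofFn, hlen]
      rw [hnil]
      refine iff_of_true (blockAntitone_nil _ _ _) fun p => ?_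
      have := p.2
      omega
    · rw [blockAntitone_iff hm _ 0 ⊤ (Nat.zero_le m)]
      simp only [Nat.not_lt_zero, false_imp_iff, implies_true, true_and, Nat.sub_zero,
        Nat.add_div_right _ hm, Nat.succ_inj, List.getElem_ofFn, List.length_ofFn]
      constructor
      · intro H p q hpq h
        exact H p q q.2 hpq h
      · intro H p q hq hpq h
        exact H ⟨p, by omega⟩ ⟨q, hq⟩ hpq h
  rw [this]
  exact ⟨fun h => ⟨h.1, h.2⟩, fun h => ⟨h.1, h.2⟩⟩

theorem borderStripSum_eq_tableauSum {lam mu : YoungDiagram} (hmu : mu ≤ lam) (m : ℕ)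
    (γ : List ℕ) : borderStripSum m lam mu γ =
      tableauSum lam mu (starRepeat m γ) (BlockAntitone m 0 ⊤) := by
  classical
  rw [borderStripSum, tableauSum, if_pos hmu]
  refine sum_congr ?_ fun _ _ => rfl
  ext T
  simp only [mem_filter, mem_univ, true_and, isMBorderStripTableau_iff]

end BlockCondition

section MainInduction

variable {lam : YoungDiagram}

theorem bead_fin_strictAnti (l : ℕ) (nu : YoungDiagram) :
    StrictAnti fun a : Fin l => bead nu a :=
  fun _ _ h => bead_strictAnti nu h

theorem bead_fin_inj {l : ℕ} {nu nu' : YoungDiagram} (h : nu.rowLen l = 0)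
    (h' : nu'.rowLen l = 0) :
    ((fun a : Fin l => bead nu a) = fun a : Fin l => bead nu' a) ↔ nu = nu' := by
  refine ⟨fun H => YoungDiagram.ext_rowLen fun a => ?_, fun H => by rw [H]⟩
  rcases lt_or_ge a l with ha | ha
  · have := congrFun H ⟨a, ha⟩
    simp only [bead] at this
    omega
  · have h1 := nu.rowLen_anti l a ha
    have h2 := nu'.rowLen_anti l a ha
    omega

/-- In two consecutive moves by `r`, the row of the moved bead weakly decreases if and only if the
target position increases. -/
theorem IsRibbonMove.lt_bead_iff {nu nu' nu'' : YoungDiagram} {r j i j' i' : ℕ}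
    (h : IsRibbonMove nu nu' r j i) (h' : IsRibbonMove nu' nu'' r j' i') (hr : 0 < r) :
    bead nu i + r + 1 ≤ bead nu' i' + r ↔ j' ≤ j := by
  rw [← h.bead_top, ← h'.bead_top]
  constructor
  · intro H
    by_contra hlt
    have h1 := bead_strictAnti nu'' (by omega : j < j')
    have h2 : bead nu'' j = bead nu' j := by simp only [bead, h'.rowLen_eq j (by omega)]
    omega
  · intro hj
    rcases eq_or_lt_of_le hj with rfl | hlt
    · have := h'.rowLen_lt hr le_rfl h'.le
      simp only [bead]
      omega
    · have h1 := bead_strictAnti nu'' hlt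
      have h2 := YoungDiagram.le_iff_rowLen_le.1 (h'.diagram_le hr) j
      simp only [bead] at h1 ⊢
      omega

/-- The recursions `restrictedSum_succ` and `tableauSum_cons` agree: a lower bound `q` on the targets
corresponds to an upper bound `ρ` on the row numbers. -/
theorem restrictedSum_eq_tableauSum {f : (Fin (lam.colLen 0) → ℤ) → ℤ}
    (hf : ∀ κ (σ : Perm (Fin (lam.colLen 0))), f (κ ∘ σ) = Perm.sign σ * f κ)
    {m r : ℕ} (hr : 0 < r) {α : List ℕ}
    (hbase : ∀ (nu : YoungDiagram) (ρ : ℕ∞), nu.rowLen (lam.colLen 0) = 0 →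
      f (fun a => bead nu a) = tableauSum lam nu α (BlockAntitone m 0 ρ)) (k : ℕ) :
    ∀ (nu : YoungDiagram) (q : ℤ) (ρ : ℕ∞), nu.rowLen (lam.colLen 0) = 0 →
      (∀ (i : Fin (lam.colLen 0)) nu' (j : ℕ), IsRibbonMove nu nu' r j i →
        (q ≤ bead nu i + r ↔ (j : ℕ∞) ≤ ρ)) →
      restrictedSum f r q k (fun a => bead nu a) =
        tableauSum lam nu (List.replicate k r ++ α) (BlockAntitone m k ρ) := by
  induction k with
  | zero =>
    intro nu q ρ hnu _
    rw [restrictedSum_zero]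
    exact hbase nu ρ hnu
  | succ k ih =>
    intro nu q ρ hnu hcompat
    rw [restrictedSum_succ f hr q k (bead_fin_strictAnti _ nu).injective, sum_filter]
    symm
    refine tableauSum_cons hr _ _ _ (fun i nu' j h => ?_) (fun i hno => ?_)
    · have hi := hcompat i nu' j h
      split_ifs with hq
      · have hρ := hi.1 hq
        have hjl : j < lam.colLen 0 := lt_of_le_of_lt h.le i.2
        have h' : IsRibbonMove nu nu' r ((⟨j, hjl⟩ : Fin (lam.colLen 0)) : ℕ) i := h
        rw [h'.update_bead, restrictedSum_comp_perm hf, Fin.sign_cycleIcc_of_le (by exact h.le),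
          ih nu' _ j]
        · simp only [BlockAntitone, hρ, true_and]
          push_cast
          rfl
        · rw [h.rowLen_eq _ (Or.inr i.2), hnu]
        · intro i' nu'' j' h''
          rw [h.lt_bead_iff h'' hr]
          exact Nat.cast_le.symm
      · rw [tableauSum_of_not, mul_zero]
        intro L hL
        exact hq (hi.2 hL.1)
    · split_ifs with hq
      · have hex : ∃ a ≤ (i : ℕ), bead nu a = bead nu i + r := by
          by_contra hne
          push Not at hne
          obtain ⟨nu', j, h⟩ := exists_isRibbonMove nu hr i hne
          exact hno nu' j h
        obtain ⟨a, ha, hbead⟩ := hex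
        have hne : (⟨a, lt_of_le_of_lt ha i.2⟩ : Fin (lam.colLen 0)) ≠ i := by
          intro hai
          have hai' : a = i := congrArg Fin.val hai
          rw [hai'] at hbead
          omega
        refine restrictedSum_eq_zero hf _ _ _ hne ?_
        rw [Function.update_self, Function.update_of_ne hne]
        exact hbead
      · rfl

/-- The coefficients of a product of an alternant with the polynomials `p_r ∘ h_m` are counted by
`m`-border-strip tableaux. -/
theorem alternantSum_eq_tableauSum (m : ℕ) {γ : List ℕ} (hγ : ∀ r ∈ γ, 0 < r) :
    ∀ (nu : YoungDiagram) (ρ : ℕ∞), nu.rowLen (lam.colLen 0) = 0 →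
      alternantSum m (fun a : Fin (lam.colLen 0) => bead lam a) γ (fun a => bead nu a) =
        tableauSum lam nu (starRepeat m γ) (BlockAntitone m 0 ρ) := by
  classical
  induction γ with
  | nil =>
    intro nu ρ hnu
    have h1 := tableauSum_nil (lam := lam) (nu := nu) (blockAntitone_nil m 0 ρ)
    refine Eq.trans ?_ h1.symm
    rw [Multiset.coe_nil, alternantSum_zero m (bead_fin_strictAnti _ lam)
      (bead_fin_strictAnti _ nu)]
    exact if_congr (bead_fin_inj hnu (rowLen_colLen_zero lam)) rfl rfl
  | cons r γ ih =>
    intro nu ρ hnu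
    have hr := hγ r List.mem_cons_self
    have hbase := ih fun s hs => hγ s (List.mem_cons_of_mem r hs)
    -- every target is at least `-l`, so this lower bound is no restriction
    have hsmall : ∀ i : Fin (lam.colLen 0), -(lam.colLen 0 : ℤ) ≤ bead nu i + r := fun i => by
      have := i.2
      simp only [bead]
      omega
    rw [← Multiset.cons_coe, alternantSum_cons,
      ← restrictedSum_of_forall_le _ r (-(lam.colLen 0 : ℤ)) m _ hsmall]
    have key := restrictedSum_eq_tableauSum
      (fun κ σ => alternantSum_comp_perm m (fun a : Fin (lam.colLen 0) => bead lam a) γ κ σ)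
      hr hbase m nu (-(lam.colLen 0 : ℤ)) ⊤ hnu fun i _ _ _ => iff_of_true (hsmall i) le_top
    rw [key]
    rcases Nat.eq_zero_or_pos m with rfl | hm
    · have h0 : ∀ ρ', BlockAntitone 0 0 ρ' = BlockAntitone 0 0 ρ := fun ρ' => by
        funext L
        cases L <;> rfl
      rw [h0]
      rfl
    · rw [blockAntitone_zero_eq_top hm]
      rfl

end MainInduction

theorem theorem1p1 (m n : ℕ) (lam mu : YoungDiagram) (hmu : mu ≤ lam)
    (hcard : lam.card = mu.card + m * n) (γ : Composition n) (g : Equiv.Perm (Fin n))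
    (hg : g.partition.parts = (γ.blocks : Multiset ℕ)) :
    defres (fun σ : Equiv.Perm (Fin m × Fin n) => (skewChar lam mu σ : ℂ)) g =
      (borderStripSum m lam mu γ.blocks : ℂ) := by
  have hrow : mu.rowLen (lam.colLen 0) = 0 :=
    Nat.le_zero.1 ((YoungDiagram.le_iff_rowLen_le.1 hmu _).trans (rowLen_colLen_zero lam).le)
  rw [defres_skewChar, hg, borderStripSum_eq_tableauSum hmu,
    ← alternantSum_eq_tableauSum m (fun r hr => γ.blocks_pos hr) mu ⊤ hrow]
  rfl
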